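/- Let $N>D\ge 1$ be integers, $L>0$ and $k<0$ with $|k|\neq \frac{D}{N-D}$, and put $s=\sqrt{|k|}$. Let $\mathscr S$ be the star graph with $N$ edges $e_1,\dots,e_N$ of the same length $L$, each parametrised by $[0,L]$ with $0$ at the external vertex and $L$ at the internal vertex, and let $L^2(\mathscr S)=\prod_{j=1}^N L^2((0,L),\mathbb R)$ with scalar product $\sum_j\int_0^L\psi_j\varphi_j\,dx$. Put $k_j=1$ for $j\le D$ and $k_j=k$ for $j>D$. Let $A$ be the operator $A\psi=(-k_j\psi_j'')_{j}$ on the domain of those $\psi\in\prod_j H^2(0,L)$ with $\psi_j(0)=0$ for all $j$, $\psi_1(L)=\dots=\psi_N(L)$ and $\sum_{j}k_j\psi_j'(L)=0$. Consider the positive solutions $a$ and $b$ of the dispersion relations $$\text{(a)}\quad \tan a=\frac{s(N-D)}{D}\tanh(sa),\qquad\qquad \text{(b)}\quad \tan b=\frac{D}{s(N-D)}\tanh(b/s).$$ 1. For every $n\ge 1$, each of (a) and (b) has exactly one solution, $a_n$ resp. $b_n$, in $]n\pi,(n+1)\pi[$. In $]0,\pi[$, if $|k|>\frac{D}{N-D}$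 then (a) has exactly one solution $a_0$ and (b) has none; if $|k|<\frac{D}{N-D}$ then (b) has exactly one solution $b_0$ and (a) has none. 2. For every $n\ge1$ choose an orthonormal basis $(\alpha^{n,m})_{1\le m\le D-1}$ of $\{c\in\mathbb R^N: c_j=0 \text{ for } j>D,\ \sum_j c_j=0\}$ and an orthonormal basis $(\beta^{n,m})_{1\le m\le N-D-1}$ of $\{c\in\mathbb R^N: c_j=0\text{ for }j\le D,\ \sum_jc_j=0\}$. Consider the following functions, each divided by its $L^2(\mathscr S)$-norm: * $\big(\alpha^{n,m}_j\sin(n\pi x/L)\big)_j$, for $n\ge1$, $1\le m\le D-1$, with $\lambda=(n\pi/L)^2$; * $\big(\beta^{n,m}_j\sin(n\pi x/L)\big)_j$, for $n\ge1$, $1\le m\le N-D-1$, with $\lambda=k(n\pi/L)^2$; * for every positive solution $a$ of (a), the function equal to $\frac{\sin a}{\sinh(sa)}\sinh(sax/L)$ on the edges $j\le D$ and to $\sin(ax/L)$ on the edges $j>D$, with $\lambda=k(a/L)^2$; * for every positive solution $b$ of (b), the function equal to $\sin(bx/L)$ on the edges $j\le D$ and to $\frac{\sin b}{\sinh(b/s)}\sinh\big(\frac{b}{s}\frac{x}{L}\big)$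 on the edges $j>D$, with $\lambda=(b/L)^2$. Each of these functions is an eigenfunction of $A$ with the indicated eigenvalue $\lambda$, and together they form a complete orthonormal system of $L^2(\mathscr S)$. -/

import Mathlib

open MeasureTheory Set
open scoped ContDiff

noncomputable section

/-- Lebesgue measure on an edge of length `L`, parametrised by `(0, L)`. -/
abbrev edgeMeasure (L : ℝ) : Measure ℝ := volume.restrict (Ioc 0 L)

/-- The real space `L²(0, L)` of one edge. -/
abbrev EdgeL2 (L : ℝ) : Type := Lp ℝ 2 (edgeMeasure L)

/-- The Hilbert space `L²` of the equilateral star with `N` edges of length `L`: the product of the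
spaces `L²(0, L)`, with the sum of the scalar products of the components.  On every edge the
coordinate goes from `0` at the external vertex to `L` at the internal vertex. -/
abbrev StarL2 (N : ℕ) (L : ℝ) : Type := PiLp 2 (fun _ : Fin N => EdgeL2 L)

/-- Edges with index `j < D` (counting from `0`) have conductivity `1`, the others `k`. -/
def conductivity (N D : ℕ) (k : ℝ) (j : Fin N) : ℝ := if j.val < D then 1 else k

/-! ### The operator -/

/-- `g` is the weak derivative of `f` on `(0, L)`. -/
def HasWeakDeriv (L : ℝ) (f g : ℝ → ℝ) : Prop :=
  ∀ φ : ℝ → ℝ, ContDiff ℝ ∞ φ → HasCompactSupport φ → tsupport φ ⊆ Ioo 0 L →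
    ∫ x in (0 : ℝ)..L, f x * deriv φ x = -∫ x in (0 : ℝ)..L, g x * φ x

/-- `f` belongs to `H²(0, L)`, `u` and `v` are the representatives of `f` and of its first weak
derivative that are continuous on `[0, L]` (so that their values at the endpoints are the traces of
`f` and `f'`), and `w` is the second weak derivative of `f`. -/
structure IsSobolevTwo (L : ℝ) (f : EdgeL2 L) (u v : ℝ → ℝ) (w : EdgeL2 L) : Prop where
  continuousOn_fst : ContinuousOn u (Icc 0 L)
  continuousOn_snd : ContinuousOn v (Icc 0 L)
  ae_eq : f =ᵐ[edgeMeasure L] u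
  weakDeriv_fst : HasWeakDeriv L u v
  weakDeriv_snd : HasWeakDeriv L v w

/-- The graph of the operator `A`: `ψ ∈ D(A)` and `A ψ = η`.  That is, every `ψ j` is in
`H²(0, L)`, vanishes at the external vertex, the `ψ j` agree at the internal vertex,
`∑ j, k_j ψ_j'(L) = 0`, and `η j = -k_j ψ_j''`. -/
def IsStarOperator (N D : ℕ) (k L : ℝ) (ψ η : StarL2 N L) : Prop :=
  ∃ (u v : Fin N → ℝ → ℝ) (w : Fin N → EdgeL2 L),
    (∀ j, IsSobolevTwo L (ψ j) (u j) (v j) (w j)) ∧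
    (∀ j, u j 0 = 0) ∧
    (∀ i j, u i L = u j L) ∧
    (∑ j, conductivity N D k j * v j L = 0) ∧
    (∀ j, η j = -(conductivity N D k j • w j))

/-- `ψ` is an eigenfunction of `A` with eigenvalue `ev`. -/
def IsStarEigenfunction (N D : ℕ) (k L ev : ℝ) (ψ : StarL2 N L) : Prop :=
  ψ ≠ 0 ∧ IsStarOperator N D k L ψ (ev • ψ)

/-! ### The dispersion relations -/

/-- `a` is a positive root of `tan a = (s (N - D) / D) tanh (s a)`, with `s = √|k|`. -/
def IsDispersionRootA (N D : ℕ) (k a : ℝ) : Prop :=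
  0 < a ∧ Real.tan a = √|k| * ((N : ℝ) - D) / D * Real.tanh (√|k| * a)

/-- `b` is a positive root of `tan b = (D / (s (N - D))) tanh (b / s)`, with `s = √|k|`. -/
def IsDispersionRootB (N D : ℕ) (k b : ℝ) : Prop :=
  0 < b ∧ Real.tan b = D / (√|k| * ((N : ℝ) - D)) * Real.tanh (b / √|k|)

/-! ### The modes -/

theorem memLp_edge (L : ℝ) (f : C(ℝ, ℝ)) : MemLp f 2 (edgeMeasure L) := by
  obtain ⟨C, hC⟩ := (isCompact_Icc (a := (0 : ℝ)) (b := L)).exists_bound_of_continuousOn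
    f.continuous.continuousOn
  refine MemLp.of_bound f.continuous.aestronglyMeasurable C ?_
  filter_upwards [ae_restrict_mem measurableSet_Ioc] with x hx
  exact hC x (Ioc_subset_Icc_self hx)

/-- The element of `L²` of the star whose component on the edge `j` is `f j`. -/
def starMk {N : ℕ} (L : ℝ) (f : Fin N → C(ℝ, ℝ)) : StarL2 N L :=
  WithLp.toLp 2 (fun j => (memLp_edge L (f j)).toLp (f j))

/-- Division by the norm. -/
def normalized {N : ℕ} {L : ℝ} (ψ : StarL2 N L) : StarL2 N L := ‖ψ‖⁻¹ • ψ

/-- Coefficient vectors supported on the edges in the set `P` and with zero sum. -/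
def zeroSum (N : ℕ) (P : Set (Fin N)) : Submodule ℝ (EuclideanSpace ℝ (Fin N)) where
  carrier := {c | (∀ j, j ∉ P → c j = 0) ∧ ∑ j, c j = 0}
  zero_mem' := by simp
  add_mem' := by
    rintro c d ⟨hc, hc'⟩ ⟨hd, hd'⟩
    refine ⟨fun j hj => ?_, ?_⟩
    · simp [hc j hj, hd j hj]
    · simp [Finset.sum_add_distrib, hc', hd']
  smul_mem' := by
    rintro r c ⟨hc, hc'⟩
    refine ⟨fun j hj => ?_, ?_⟩
    · simp [hc j hj]
    · simp [← Finset.mul_sum, hc']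

/-- The edges of conductivity `1`. -/
def positivePhase (N D : ℕ) : Set (Fin N) := {j | j.val < D}

/-- The edges of conductivity `k`. -/
def negativePhase (N D : ℕ) : Set (Fin N) := {j | D ≤ j.val}

/-- The function with components `c j * sin (n π x / L)`. -/
def sineMode {N : ℕ} (L : ℝ) (c : EuclideanSpace ℝ (Fin N)) (n : ℕ+) : StarL2 N L :=
  starMk L fun j => ⟨fun x => c j * Real.sin (n * Real.pi * x / L), by fun_prop⟩

/-- The function equal to `sin a / sinh (s a) * sinh (s a x / L)` on the edges of conductivity `1`
and to `sin (a x / L)` on the edges of conductivity `k`, with `s = √|k|`. -/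
def mixedModeA (N D : ℕ) (k L a : ℝ) : StarL2 N L :=
  starMk L fun j =>
    if j.val < D then
      ⟨fun x => Real.sin a / Real.sinh (√|k| * a) * Real.sinh (√|k| * a * x / L), by fun_prop⟩
    else ⟨fun x => Real.sin (a * x / L), by fun_prop⟩

/-- The function equal to `sin (b x / L)` on the edges of conductivity `1` and to
`sin b / sinh (b / s) * sinh (b x / (s L))` on the edges of conductivity `k`, with `s = √|k|`. -/
def mixedModeB (N D : ℕ) (k L b : ℝ) : StarL2 N L :=
  starMk L fun j =>
    if j.val < D then ⟨fun x => Real.sin (b * x / L), by fun_prop⟩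
    else
      ⟨fun x => Real.sin b / Real.sinh (b / √|k|) * Real.sinh (b / √|k| * x / L), by fun_prop⟩

/-- The indices of the modes: sine modes on the edges of conductivity `1` (`D - 1` for every
`n ≥ 1`), sine modes on the edges of conductivity `k` (`N - D - 1` for every `n ≥ 1`), and one
mixed mode for every positive root of each of the two dispersion relations. -/
inductive ModeIndex (N D : ℕ) (k : ℝ) : Type
  | sinePos (n : ℕ+) (m : Fin (D - 1)) : ModeIndex N D k
  | sineNeg (n : ℕ+) (m : Fin (N - D - 1)) : ModeIndex N D k
  | mixedA (a : {a : ℝ // IsDispersionRootA N D k a}) : ModeIndex N D k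
  | mixedB (b : {b : ℝ // IsDispersionRootB N D k b}) : ModeIndex N D k

/-- The eigenvalue that belongs to a mode. -/
def modeEigenvalue (N D : ℕ) (k L : ℝ) : ModeIndex N D k → ℝ
  | .sinePos n _ => (n * Real.pi / L) ^ 2
  | .sineNeg n _ => k * (n * Real.pi / L) ^ 2
  | .mixedA a => k * ((a : ℝ) / L) ^ 2
  | .mixedB b => ((b : ℝ) / L) ^ 2

/-- The normalized modes.  For every `n ≥ 1`, the coefficients of the sine modes run through the
chosen orthonormal bases `α n` and `β n` of the two spaces of zero-sum coefficients. -/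
def starMode (N D : ℕ) (k L : ℝ)
    (α : ℕ+ → OrthonormalBasis (Fin (D - 1)) ℝ (zeroSum N (positivePhase N D)))
    (β : ℕ+ → OrthonormalBasis (Fin (N - D - 1)) ℝ (zeroSum N (negativePhase N D))) :
    ModeIndex N D k → StarL2 N L
  | .sinePos n m => normalized (sineMode L (α n m : EuclideanSpace ℝ (Fin N)) n)
  | .sineNeg n m => normalized (sineMode L (β n m : EuclideanSpace ℝ (Fin N)) n)
  | .mixedA a => normalized (mixedModeA N D k L a)
  | .mixedB b => normalized (mixedModeB N D k L b)

end

/-!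
The operator `A` is inverted explicitly. On every edge the problem `-k_j u'' = f`, `u 0 = u L = 0`
is solved by `1 / k_j` times the integral operator with the Green function `min x t - x t / L`
(`greenOp`). To these solutions one adds a common multiple of the coordinate `x`, chosen such that
the condition on the derivatives at the internal vertex holds. The multiple is determined exactly
when the sum `D + k (N - D)` of the conductivities is not zero, that is, when `|k| ≠ D / (N - D)`.
The resulting bounded operator `starInverse` is symmetric, because the Green operator is symmetric
and the correction is a multiple of the projection onto the coordinate function. It is compact,
because an integral operator with a continuous family of sections is a limit of operators of finite
rank (`isCompactOperator_kernelOp`). By the spectral theorem its eigenspaces have trivial orthogonal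
complement, and its kernel is zero because its range contains the test functions
(`starInverse_injective`).

Completeness therefore reduces to the eigenvectors of `starInverse`. The integral equation shows
that such an eigenvector is a classical solution of `-k_j u'' = ev u`, hence on every edge a
multiple of a sine or of a hyperbolic sine (`exists_coeff_of_starInverse_eq`). On the edges whose
conductivity has the sign of `ev` the solution oscillates. Either it vanishes at the internal
vertex, which gives the sine modes, or the conditions there amount to a dispersion relation, which
gives the mixed modes (`mem_span_of_eigenvalue_pos`, `mem_span_of_eigenvalue_neg`).

Modes with different eigenvalues are orthogonal by symmetry. Equal eigenvalues only occur among the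
sine modes of one phase and one frequency, which are orthogonal by the choice of their coefficients.

The roots of `tan a = c tanh (r a)` lie in the intervals `]nπ, nπ + π/2[`, where
`tan a / tanh (r a)` is strictly increasing (`tan_mul_coth_strictMonoOn`). In `]0, π/2[` a root
exists if and only if the slope `c r` of the right-hand side at `0` exceeds `1`.
-/

/-! ### Roots of the dispersion relations -/

/-- The sign of the derivative is that of `sinh (2 r a) - r sin (2 a)`, and
`sinh (2 r a) > 2 r a > r sin (2 a)`. -/
theorem tan_mul_coth_strictMonoOn {r : ℝ} (hr : 0 < r) (n : ℕ) :
    StrictMonoOn (fun a => Real.tan a * Real.cosh (r * a) / Real.sinh (r * a))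
      (Ioo (n * Real.pi) (n * Real.pi + Real.pi / 2)) := by
  have hpos : ∀ a ∈ Ioo (n * Real.pi) (n * Real.pi + Real.pi / 2), 0 < a := fun a ha =>
    lt_of_le_of_lt (by positivity) ha.1
  have hcos : ∀ a ∈ Ioo (n * Real.pi) (n * Real.pi + Real.pi / 2), Real.cos a ≠ 0 := by
    intro a ha h
    have h1 : 0 < Real.cos (a - n * Real.pi) :=
      Real.cos_pos_of_mem_Ioo ⟨by linarith [ha.1, Real.pi_pos], by linarith [ha.2]⟩
    rw [Real.cos_sub_nat_mul_pi, h, mul_zero] at h1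
    exact lt_irrefl _ h1
  have hderiv : ∀ a ∈ Ioo (n * Real.pi) (n * Real.pi + Real.pi / 2),
      HasDerivAt (fun a => Real.tan a * Real.cosh (r * a) / Real.sinh (r * a))
        ((Real.sinh (r * a) * Real.cosh (r * a) - r * (Real.sin a * Real.cos a)) /
          (Real.cos a ^ 2 * Real.sinh (r * a) ^ 2)) a := by
    intro a ha
    have hs : Real.sinh (r * a) ≠ 0 := (Real.sinh_pos_iff.2 (mul_pos hr (hpos a ha))).ne'
    have hlin : HasDerivAt (fun x : ℝ => r * x) r a := by
      simpa using (hasDerivAt_id a).const_mul r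
    refine (((Real.hasDerivAt_tan (hcos a ha)).mul hlin.cosh).div hlin.sinh hs).congr_deriv ?_
    have := Real.cosh_sq (r * a)
    have hc := hcos a ha
    simp only [Pi.mul_apply, Real.tan_eq_sin_div_cos]
    field_simp
    linear_combination (-r * Real.sin a * Real.cos a) * this
  refine strictMonoOn_of_deriv_pos (convex_Ioo _ _)
    (fun a ha => (hderiv a ha).continuousAt.continuousWithinAt) fun a ha => ?_
  rw [interior_Ioo] at ha
  rw [(hderiv a ha).deriv]
  have ha0 := hpos a ha
  have h1 := Real.self_lt_sinh_iff.2 (show 0 < 2 * (r * a) by positivity)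
  have h2 := Real.sin_lt (show 0 < 2 * a by positivity)
  rw [Real.sinh_two_mul] at h1
  rw [Real.sin_two_mul] at h2
  have hs : Real.sinh (r * a) ≠ 0 := (Real.sinh_pos_iff.2 (mul_pos hr ha0)).ne'
  have hc := hcos a ha
  refine div_pos ?_ (by positivity)
  nlinarith

/-- Roots of a dispersion relation lie in the first half of the intervals `]nπ, (n+1)π[`, where the
tangent is positive. -/
theorem dispersion_root_mem_Ioo {r c a : ℝ} (hr : 0 < r) (hc : 0 < c) {n : ℕ}
    (ha : a ∈ Ioo (n * Real.pi) ((n + 1) * Real.pi)) (h : Real.tan a = c * Real.tanh (r * a)) :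
    a ∈ Ioo (n * Real.pi) (n * Real.pi + Real.pi / 2) := by
  refine ⟨ha.1, ?_⟩
  by_contra! hle
  have ha0 : 0 < a := lt_of_le_of_lt (by positivity) ha.1
  have h1 : Real.tan (a - (n + 1 : ℕ) * Real.pi) ≤ 0 := by
    apply Real.tan_nonpos_of_nonpos_of_neg_pi_div_two_le
    · push_cast
      linarith [ha.2]
    · push_cast
      linarith
  rw [Real.tan_sub_nat_mul_pi, h, Real.tanh_eq_sinh_div_cosh] at h1
  have := Real.sinh_pos_iff.2 (mul_pos hr ha0)
  have := Real.cosh_pos (r * a)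
  have : 0 < c * (Real.sinh (r * a) / Real.cosh (r * a)) := by positivity
  linarith

theorem dispersion_root_iff {r c a : ℝ} (hr : 0 < r) (ha : 0 < a) :
    Real.tan a = c * Real.tanh (r * a) ↔
      Real.tan a * Real.cosh (r * a) / Real.sinh (r * a) = c := by
  have h1 := (Real.sinh_pos_iff.2 (mul_pos hr ha)).ne'
  have h2 := (Real.cosh_pos (r * a)).ne'
  rw [Real.tanh_eq_sinh_div_cosh, div_eq_iff h1, ← mul_div_assoc, eq_div_iff h2]

theorem dispersion_root_unique {r c a b : ℝ} (hr : 0 < r) (hc : 0 < c) {n : ℕ}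
    (ha : a ∈ Ioo (n * Real.pi) ((n + 1) * Real.pi)) (h : Real.tan a = c * Real.tanh (r * a))
    (hb : b ∈ Ioo (n * Real.pi) ((n + 1) * Real.pi)) (h' : Real.tan b = c * Real.tanh (r * b)) :
    a = b := by
  have ha0 : 0 < a := lt_of_le_of_lt (by positivity) ha.1
  have hb0 : 0 < b := lt_of_le_of_lt (by positivity) hb.1
  refine (tan_mul_coth_strictMonoOn hr n).injOn (dispersion_root_mem_Ioo hr hc ha h)
    (dispersion_root_mem_Ioo hr hc hb h') ?_
  exact ((dispersion_root_iff hr ha0).1 h).trans ((dispersion_root_iff hr hb0).1 h').symm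

/-- A sign change of `sin x cosh (r (x + nπ)) - c cos x sinh (r (x + nπ))` produces a root: this
function is positive at `x = π / 2`. -/
theorem exists_dispersion_root {r c : ℝ} {n : ℕ} {y : ℝ} (hy0 : 0 ≤ y)
    (hy : y < Real.pi / 2)
    (hneg : Real.sin y * Real.cosh (r * (y + n * Real.pi)) -
      c * (Real.cos y * Real.sinh (r * (y + n * Real.pi))) < 0) :
    ∃ a ∈ Ioo (n * Real.pi) ((n + 1) * Real.pi), Real.tan a = c * Real.tanh (r * a) := by
  have hcont : ContinuousOn (fun x => Real.sin x * Real.cosh (r * (x + n * Real.pi)) -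
      c * (Real.cos x * Real.sinh (r * (x + n * Real.pi)))) (Icc y (Real.pi / 2)) := by fun_prop
  obtain ⟨x, hx, hx0⟩ := intermediate_value_Ioo hy.le hcont
    (show (0 : ℝ) ∈ Ioo _ _ from ⟨hneg, by simpa using Real.cosh_pos _⟩)
  refine ⟨x + n * Real.pi, ⟨by linarith [hx.1], by linarith [hx.2, Real.pi_pos]⟩, ?_⟩
  have hcos : Real.cos x ≠ 0 :=
    (Real.cos_pos_of_mem_Ioo ⟨by linarith [hx.1, Real.pi_pos], hx.2⟩).ne'
  have := (Real.cosh_pos (r * (x + n * Real.pi))).ne'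
  rw [Real.tan_add_nat_mul_pi, Real.tan_eq_sin_div_cos, Real.tanh_eq_sinh_div_cosh]
  field_simp
  simp only at hx0
  linarith

theorem existsUnique_dispersion_root {r c : ℝ} (hr : 0 < r) (hc : 0 < c) {n : ℕ} (hn : 1 ≤ n) :
    ∃! a : ℝ, a ∈ Ioo (n * Real.pi) ((n + 1) * Real.pi) ∧
      (0 < a ∧ Real.tan a = c * Real.tanh (r * a)) := by
  obtain ⟨a, ha, h⟩ := exists_dispersion_root (r := r) (c := c) (n := n) le_rfl
    (by positivity) (by
      have h1 : (0 : ℝ) < r * (0 + n * Real.pi) := by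
        have : (0 : ℝ) < n := by exact_mod_cast hn
        have := Real.pi_pos
        simp only [zero_add]
        positivity
      have := Real.sinh_pos_iff.2 h1
      simp only [Real.sin_zero, Real.cos_zero, zero_mul, one_mul, zero_sub]
      have : 0 < c * Real.sinh (r * (0 + n * Real.pi)) := by positivity
      linarith)
  refine ⟨a, ⟨ha, lt_of_le_of_lt (by positivity) ha.1, h⟩, ?_⟩
  rintro b ⟨hb, -, h'⟩
  exact dispersion_root_unique hr hc hb h' ha h

/-- On `]0, π[` the outcome is decided by the slopes of both sides at `0`: a root exists if the
slope `c * r` of the right-hand side exceeds the slope `1` of the tangent. -/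
theorem existsUnique_dispersion_root_zero {r c : ℝ} (hr : 0 < r) (hc : 0 < c) (hcr : 1 < c * r) :
    ∃! a : ℝ, a ∈ Ioo 0 Real.pi ∧ (0 < a ∧ Real.tan a = c * Real.tanh (r * a)) := by
  have hder : HasDerivAt (fun x => Real.sin x * Real.cosh (r * x) -
      c * (Real.cos x * Real.sinh (r * x))) (1 - c * r) 0 := by
    have hlin : HasDerivAt (fun x : ℝ => r * x) r 0 := by
      simpa using (hasDerivAt_id (0 : ℝ)).const_mul r
    refine (((Real.hasDerivAt_sin 0).mul hlin.cosh).sub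
      (((Real.hasDerivAt_cos 0).mul hlin.sinh).const_mul c)).congr_deriv ?_
    simp
  have hev : ∀ᶠ x in nhdsWithin (0 : ℝ) (Ioi 0), Real.sin x * Real.cosh (r * x) -
      c * (Real.cos x * Real.sinh (r * x)) < 0 := by
    have h1 := (hasDerivAt_iff_tendsto_slope.1 hder).mono_left
      (nhdsWithin_mono (0 : ℝ) (show Ioi (0 : ℝ) ⊆ {0}ᶜ from fun x hx => ne_of_gt hx))
    filter_upwards [h1.eventually_lt_const (show 1 - c * r < 0 by linarith),
      self_mem_nhdsWithin] with x hx hx0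
    rw [slope_def_field] at hx
    simp only [Real.sin_zero, mul_zero, Real.sinh_zero, zero_mul, sub_zero] at hx
    exact (div_neg_iff.1 hx).resolve_left (fun h => not_lt.2 (le_of_lt hx0) h.2) |>.1
  obtain ⟨y, hy, hyneg⟩ :=
    (hev.and (Ioo_mem_nhdsGT (show (0 : ℝ) < Real.pi / 2 by positivity))).exists
  obtain ⟨a, ha, h⟩ := exists_dispersion_root (r := r) (c := c) (n := 0) hyneg.1.le hyneg.2
    (by simpa using hy)
  have ha' : a ∈ Ioo 0 Real.pi := by simpa using ha
  refine ⟨a, ⟨ha', ha'.1, h⟩, ?_⟩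
  rintro b ⟨hb, -, h'⟩
  exact dispersion_root_unique hr hc (n := 0) (by simpa using hb) h' ha h

theorem no_dispersion_root_zero {r c : ℝ} (hr : 0 < r) (hc : 0 < c) (hcr : c * r ≤ 1) :
    ¬ ∃ a : ℝ, a ∈ Ioo 0 Real.pi ∧ (0 < a ∧ Real.tan a = c * Real.tanh (r * a)) := by
  rintro ⟨a, ha, ha0, h⟩
  have h1 := dispersion_root_mem_Ioo hr hc (n := 0) (by simpa using ha) h
  have h2 : a < Real.tan a := Real.lt_tan ha0 (by simpa using h1.2)
  have h3 : Real.sinh (r * a) < r * a * Real.cosh (r * a) := by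
    have hmono : StrictMonoOn (fun x => x * Real.cosh x - Real.sinh x) (Ici 0) := by
      refine strictMonoOn_of_deriv_pos (convex_Ici 0) (by fun_prop) fun x hx => ?_
      rw [interior_Ici] at hx
      have : HasDerivAt (fun x => x * Real.cosh x - Real.sinh x) (x * Real.sinh x) x := by
        refine (((hasDerivAt_id x).mul (Real.hasDerivAt_cosh x)).sub
          (Real.hasDerivAt_sinh x)).congr_deriv ?_
        simp
      rw [this.deriv]
      exact mul_pos hx (Real.sinh_pos_iff.2 hx)
    have := hmono (self_mem_Ici) (show r * a ∈ Ici 0 from (mul_pos hr ha0).le) (mul_pos hr ha0)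
    simp at this
    linarith
  have h4 : Real.tanh (r * a) < r * a := by
    rw [Real.tanh_eq_sinh_div_cosh, div_lt_iff₀ (Real.cosh_pos _)]
    exact h3
  nlinarith

/-! ### Continuous functions in `L²(0, L)` -/

/-- The element of `L²(0, L)` given by a continuous function. -/
noncomputable def edgeMk (L : ℝ) (f : C(ℝ, ℝ)) : EdgeL2 L := (memLp_edge L f).toLp f

theorem edgeMk_coeFn (L : ℝ) (f : C(ℝ, ℝ)) : edgeMk L f =ᵐ[edgeMeasure L] f :=
  MemLp.coeFn_toLp _

theorem edgeMk_add (L : ℝ) (f g : C(ℝ, ℝ)) : edgeMk L (f + g) = edgeMk L f + edgeMk L g := rfl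

theorem edgeMk_sub (L : ℝ) (f g : C(ℝ, ℝ)) : edgeMk L (f - g) = edgeMk L f - edgeMk L g := rfl

theorem edgeMk_smul (L c : ℝ) (f : C(ℝ, ℝ)) : edgeMk L (c • f) = c • edgeMk L f := rfl

theorem edgeMk_congr {L : ℝ} {f g : C(ℝ, ℝ)} (h : EqOn f g (Icc 0 L)) :
    edgeMk L f = edgeMk L g := by
  refine (MemLp.toLp_eq_toLp_iff _ _).2 ?_
  filter_upwards [ae_restrict_mem measurableSet_Ioc] with x hx
  exact h (Ioc_subset_Icc_self hx)

theorem inner_edgeMk_left {L : ℝ} (f : C(ℝ, ℝ)) (g : EdgeL2 L) :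
    inner ℝ (edgeMk L f) g = ∫ x, f x * g x ∂edgeMeasure L := by
  rw [L2.inner_def]
  refine integral_congr_ae ?_
  filter_upwards [edgeMk_coeFn L f] with x hx
  simp [hx, mul_comm]

theorem inner_edgeMk_edgeMk {L : ℝ} (hL : 0 ≤ L) (f g : C(ℝ, ℝ)) :
    inner ℝ (edgeMk L f) (edgeMk L g) = ∫ x in (0 : ℝ)..L, f x * g x := by
  rw [inner_edgeMk_left, intervalIntegral.integral_of_le hL]
  refine integral_congr_ae ?_
  filter_upwards [edgeMk_coeFn L g] with x hx
  rw [hx]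

/-- The constant that bounds the `L²` norm on an edge by the supremum norm. -/
noncomputable def supToL2 (L : ℝ) : ℝ :=
  (measureUnivNNReal (edgeMeasure L) : ℝ) ^ (2 : ENNReal).toReal⁻¹

theorem supToL2_nonneg (L : ℝ) : 0 ≤ supToL2 L := by
  unfold supToL2
  positivity

theorem norm_edgeMk_le {L C : ℝ} (hC : 0 ≤ C) {f : C(ℝ, ℝ)} (h : ∀ x ∈ Icc 0 L, |f x| ≤ C) :
    ‖edgeMk L f‖ ≤ supToL2 L * C := by
  refine Lp.norm_le_of_ae_bound hC ?_
  filter_upwards [edgeMk_coeFn L f, ae_restrict_mem measurableSet_Ioc] with x hx hx'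
  rw [hx]
  exact h x (Ioc_subset_Icc_self hx')

/-! ### Integral operators with continuous kernels -/

/-- The continuous function `x ↦ ⟪κ x, f⟫`. -/
noncomputable def kernelFun {L : ℝ} (κ : C(ℝ, EdgeL2 L)) (f : EdgeL2 L) : C(ℝ, ℝ) :=
  ⟨fun x => inner ℝ (κ x) f, by fun_prop⟩

theorem kernelFun_apply {L : ℝ} (κ : C(ℝ, EdgeL2 L)) (f : EdgeL2 L) (x : ℝ) :
    kernelFun κ f x = inner ℝ (κ x) f := rfl

theorem exists_kernel_bound {L : ℝ} (κ : C(ℝ, EdgeL2 L)) :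
    ∃ C, ∀ f, ‖edgeMk L (kernelFun κ f)‖ ≤ C * ‖f‖ := by
  obtain ⟨C, hC⟩ := (isCompact_Icc (a := (0 : ℝ)) (b := L)).exists_bound_of_continuousOn
    κ.continuous.continuousOn
  refine ⟨supToL2 L * max C 0, fun f => ?_⟩
  rw [mul_assoc]
  refine norm_edgeMk_le (by positivity) fun x hx => ?_
  refine (norm_inner_le_norm (𝕜 := ℝ) (κ x) f).trans ?_
  gcongr
  exact (hC x hx).trans (le_max_left _ _)

/-- The integral operator on `L²(0, L)` whose kernel is given by its sections `κ x`, which depend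
continuously on `x`: it maps `f` to `x ↦ ⟪κ x, f⟫`. -/
noncomputable def kernelOp {L : ℝ} (κ : C(ℝ, EdgeL2 L)) : EdgeL2 L →L[ℝ] EdgeL2 L :=
  LinearMap.mkContinuousOfExistsBound
    { toFun := fun f => edgeMk L (kernelFun κ f)
      map_add' := fun f g => by
        rw [← edgeMk_add]
        congr 1
        ext x
        simp [kernelFun_apply, inner_add_right]
      map_smul' := fun c f => by
        rw [RingHom.id_apply, ← edgeMk_smul]
        congr 1
        ext x
        simp [kernelFun_apply, inner_smul_right] }
    (exists_kernel_bound κ)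

theorem kernelOp_apply {L : ℝ} (κ : C(ℝ, EdgeL2 L)) (f : EdgeL2 L) :
    kernelOp κ f = edgeMk L (kernelFun κ f) := rfl

/-- The sections `κ x`, `x ∈ [0, L]`, form a compact set, which lies within `ε` of a subspace of
finite dimension.  Composing with the projection onto it approximates the operator by operators of
finite rank. -/
theorem isCompactOperator_kernelOp {L : ℝ} (κ : C(ℝ, EdgeL2 L)) :
    IsCompactOperator (kernelOp κ) := by
  refine (isClosed_setOfPred_isCompactOperator (σ₁₂ := RingHom.id ℝ)
    (M₁ := EdgeL2 L) (M₂ := EdgeL2 L)).closure_subset (Metric.mem_closure_iff.2 fun ε hε => ?_)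
  set M := supToL2 L + 1 with hM
  have hM0 : 0 < M := by linarith [supToL2_nonneg L]
  set δ := ε / (2 * M) with hδ
  have hδ0 : 0 < δ := by positivity
  obtain ⟨t, ht, hcover⟩ := Metric.totallyBounded_iff.1
    ((isCompact_Icc (a := (0 : ℝ)) (b := L)).image κ.continuous).totallyBounded δ hδ0
  set F := Submodule.span ℝ t
  have : FiniteDimensional ℝ F := FiniteDimensional.span_of_finite ℝ ht
  have hproj : ∀ x ∈ Icc 0 L, ‖κ x - F.starProjection (κ x)‖ ≤ δ := by
    intro x hx
    obtain ⟨y, hy, hxy⟩ := mem_iUnion₂.1 (hcover (mem_image_of_mem κ hx))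
    have hyF : F.starProjection y = y :=
      Submodule.starProjection_eq_self_iff.2 (Submodule.subset_span hy)
    have : κ x - F.starProjection (κ x) = Fᗮ.starProjection (κ x - y) := by
      rw [Submodule.starProjection_orthogonal']
      simp [hyF]
    rw [this]
    refine (ContinuousLinearMap.le_of_opNorm_le _ Fᗮ.starProjection_norm_le _).trans ?_
    rw [one_mul, ← dist_eq_norm]
    exact (Metric.mem_ball.1 hxy).le
  refine ⟨kernelOp κ ∘L F.starProjection, ?_, ?_⟩
  · exact (isCompactOperator_of_locallyCompactSpace_dom F.orthogonalProjectionOnto).clm_comp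
      (kernelOp κ ∘L F.subtypeL)
  · rw [dist_eq_norm]
    refine lt_of_le_of_lt (ContinuousLinearMap.opNorm_le_bound _ (M := supToL2 L * δ)
      (mul_nonneg (supToL2_nonneg L) hδ0.le) fun f => ?_) ?_
    · have : (kernelOp κ - kernelOp κ ∘L F.starProjection) f =
          edgeMk L (kernelFun κ f - kernelFun κ (F.starProjection f)) := rfl
      rw [this, mul_assoc]
      refine norm_edgeMk_le (by positivity) fun x hx => ?_
      have : (kernelFun κ f - kernelFun κ (F.starProjection f)) x =
          inner ℝ (κ x - F.starProjection (κ x)) f := by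
        simp only [ContinuousMap.sub_apply, kernelFun_apply, inner_sub_left]
        rw [Submodule.inner_starProjection_left_eq_right]
      rw [this]
      refine (norm_inner_le_norm (𝕜 := ℝ) _ f).trans ?_
      gcongr
      exact hproj x hx
    · have h1 : supToL2 L * δ ≤ M * δ := by
        gcongr
        linarith
      have h2 : M * δ = ε / 2 := by
        rw [hδ]
        field_simp
      linarith

/-! ### The Dirichlet problem on an edge -/

/-- The section at `x` of the Green function `min x t - x t / L` of `-d²/dt²` on `(0, L)` with
Dirichlet conditions. -/
noncomputable def greenFun (L x : ℝ) : C(ℝ, ℝ) := ⟨fun t => min x t - x * t / L, by fun_prop⟩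

theorem greenFun_apply (L x t : ℝ) : greenFun L x t = min x t - x * t / L := rfl

theorem greenFun_symm (L x t : ℝ) : greenFun L x t = greenFun L t x := by
  rw [greenFun_apply, greenFun_apply, min_comm, mul_comm]

theorem abs_greenFun_sub_le {L : ℝ} (hL : 0 < L) {x y t : ℝ} (ht : t ∈ Icc 0 L) :
    |greenFun L x t - greenFun L y t| ≤ 2 * |x - y| := by
  have h1 : |min x t - min y t| ≤ |x - y| := by
    simpa using abs_min_sub_min_le_max x t y t
  have h2 : |(x - y) * (t / L)| ≤ |x - y| := by
    rw [abs_mul]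
    refine mul_le_of_le_one_right (abs_nonneg _) ?_
    rw [abs_of_nonneg (div_nonneg ht.1 hL.le)]
    exact (div_le_one hL).2 ht.2
  have : greenFun L x t - greenFun L y t = (min x t - min y t) - (x - y) * (t / L) := by
    simp only [greenFun_apply]
    ring
  rw [this]
  exact (abs_sub _ _).trans (by linarith)

/-- The sections of the Green function, as a continuous family in `L²(0, L)`. -/
noncomputable def greenSection (L : ℝ) (hL : 0 < L) : C(ℝ, EdgeL2 L) where
  toFun x := edgeMk L (greenFun L x)
  continuous_toFun := by
    refine (LipschitzWith.of_dist_le_mul (K := Real.toNNReal (supToL2 L * 2))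
      fun x y => ?_).continuous
    rw [dist_eq_norm, ← edgeMk_sub, Real.coe_toNNReal _ (mul_nonneg (supToL2_nonneg L) zero_le_two),
      mul_assoc]
    exact norm_edgeMk_le (by positivity) fun t ht => abs_greenFun_sub_le hL ht

/-- The inverse of `-d²/dx²` on `(0, L)` with Dirichlet conditions at both ends. -/
noncomputable def greenOp (L : ℝ) (hL : 0 < L) : EdgeL2 L →L[ℝ] EdgeL2 L :=
  kernelOp (greenSection L hL)

theorem greenOp_symm {L : ℝ} (hL : 0 < L) (f g : EdgeL2 L) :
    inner ℝ (greenOp L hL f) g = inner ℝ f (greenOp L hL g) := by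
  have hcont : Continuous fun z : ℝ × ℝ => greenFun L z.1 z.2 := by
    simp only [greenFun_apply]
    fun_prop
  have hfun : ∀ f g : EdgeL2 L, inner ℝ (greenOp L hL f) g =
      ∫ x, ∫ t, greenFun L x t * (g x * f t) ∂edgeMeasure L ∂edgeMeasure L := by
    intro f g
    rw [greenOp, kernelOp_apply, inner_edgeMk_left]
    refine integral_congr_ae (Filter.Eventually.of_forall fun x => ?_)
    have : kernelFun (greenSection L hL) f x = ∫ t, greenFun L x t * f t ∂edgeMeasure L :=
      inner_edgeMk_left _ _
    simp only
    rw [this, mul_comm, ← integral_const_mul]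
    refine integral_congr_ae (Filter.Eventually.of_forall fun t => ?_)
    simp only
    ring
  have hint : Integrable (Function.uncurry fun x t => greenFun L x t * (g x * f t))
      ((edgeMeasure L).prod (edgeMeasure L)) := by
    have hf : Integrable f (edgeMeasure L) := (Lp.memLp f).integrable one_le_two
    have hg : Integrable g (edgeMeasure L) := (Lp.memLp g).integrable one_le_two
    obtain ⟨C, hC⟩ := ((isCompact_Icc (a := (0 : ℝ)) (b := L)).prod
      (isCompact_Icc (a := (0 : ℝ)) (b := L))).exists_bound_of_continuousOn hcont.continuousOn
    refine (hg.mul_prod hf).bdd_mul (c := C) hcont.aestronglyMeasurable ?_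
    rw [Measure.prod_restrict]
    filter_upwards [ae_restrict_mem (measurableSet_Ioc.prod measurableSet_Ioc)] with z hz
    exact hC z ⟨Ioc_subset_Icc_self hz.1, Ioc_subset_Icc_self hz.2⟩
  rw [hfun, integral_integral_swap hint, real_inner_comm, hfun]
  refine integral_congr_ae (Filter.Eventually.of_forall fun x =>
    integral_congr_ae (Filter.Eventually.of_forall fun t => ?_))
  simp only
  rw [greenFun_symm, mul_comm (g t)]

/-- Green's representation formula, by integration by parts on both sides of `x`. -/
theorem inner_greenSection {L : ℝ} (hL : 0 < L) {u v : ℝ → ℝ} {w : C(ℝ, ℝ)}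
    (hu : ∀ x, HasDerivAt u (v x) x) (hv : ∀ x, HasDerivAt v (w x) x) (hu0 : u 0 = 0)
    {x : ℝ} (hx : x ∈ Icc 0 L) :
    kernelFun (greenSection L hL) (edgeMk L w) x = x * u L / L - u x := by
  have hLne := hL.ne'
  have : kernelFun (greenSection L hL) (edgeMk L w) x = ∫ t in (0 : ℝ)..L, greenFun L x t * w t :=
    inner_edgeMk_edgeMk hL.le _ _
  rw [this, ← intervalIntegral.integral_add_adjacent_intervals (b := x)
    (Continuous.intervalIntegrable (by fun_prop) _ _)
    (Continuous.intervalIntegrable (by fun_prop) _ _)]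
  have h1 : ∫ t in (0 : ℝ)..x, greenFun L x t * w t =
      (1 - x / L) * (x * v x - u x) - (1 - x / L) * (0 * v 0 - u 0) := by
    refine intervalIntegral.integral_eq_sub_of_hasDerivAt
      (f := fun t => (1 - x / L) * (t * v t - u t)) (fun t ht => ?_)
      (Continuous.intervalIntegrable (by fun_prop) _ _)
    rw [uIcc_of_le hx.1] at ht
    refine ((((hasDerivAt_id t).mul (hv t)).sub (hu t)).const_mul _).congr_deriv ?_
    rw [greenFun_apply, min_eq_right ht.2]
    simp only [id]
    field_simp
    ring
  have h2 : ∫ t in x..L, greenFun L x t * w t =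
      x * ((1 - L / L) * v L + u L / L) - x * ((1 - x / L) * v x + u x / L) := by
    refine intervalIntegral.integral_eq_sub_of_hasDerivAt
      (f := fun t => x * ((1 - t / L) * v t + u t / L)) (fun t ht => ?_)
      (Continuous.intervalIntegrable (by fun_prop) _ _)
    rw [uIcc_of_le hx.2] at ht
    have h3 : HasDerivAt (fun t : ℝ => 1 - t / L) (-(1 / L)) t :=
      ((hasDerivAt_id t).div_const L).const_sub 1
    refine (((h3.mul (hv t)).add ((hu t).div_const L)).const_mul x).congr_deriv ?_
    rw [greenFun_apply, min_eq_left ht.1]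
    field_simp
    ring
  rw [h1, h2, hu0]
  field_simp
  ring

theorem integral_id_mul_deriv_deriv {L : ℝ} {u v : ℝ → ℝ} {w : C(ℝ, ℝ)}
    (hu : ∀ x, HasDerivAt u (v x) x) (hv : ∀ x, HasDerivAt v (w x) x) (hu0 : u 0 = 0) :
    ∫ t in (0 : ℝ)..L, t * w t = L * v L - u L := by
  rw [intervalIntegral.integral_eq_sub_of_hasDerivAt (f := fun t => t * v t - u t)
    (fun t _ => (((hasDerivAt_id t).mul (hv t)).sub (hu t)).congr_deriv (by simp))
    (Continuous.intervalIntegrable (by fun_prop) _ _), hu0]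
  ring

/-! ### The inverse of the star operator -/

/-- A function on the star that is twice continuously differentiable on every edge and satisfies
the boundary and vertex conditions of the operator `A`; `v` and `w` are the first two derivatives of
`u`.  For convenience everything is defined on the whole line. -/
structure IsClassicalDomain (N D : ℕ) (k L : ℝ) (u : Fin N → C(ℝ, ℝ)) (v : Fin N → ℝ → ℝ)
    (w : Fin N → C(ℝ, ℝ)) : Prop where
  hasDerivAt_fst : ∀ j x, HasDerivAt (u j) (v j x) x
  hasDerivAt_snd : ∀ j x, HasDerivAt (v j) (w j x) x
  external : ∀ j, u j 0 = 0
  continuity : ∀ i j, u i L = u j L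
  kirchhoff : ∑ j, conductivity N D k j * v j L = 0

theorem starMk_apply {N : ℕ} (L : ℝ) (f : Fin N → C(ℝ, ℝ)) (j : Fin N) :
    starMk L f j = edgeMk L (f j) := rfl

theorem starMk_smul {N : ℕ} (L c : ℝ) (f : Fin N → C(ℝ, ℝ)) :
    starMk L (c • f) = c • starMk L f := rfl

theorem inner_starMk {N : ℕ} {L : ℝ} (hL : 0 ≤ L) (f g : Fin N → C(ℝ, ℝ)) :
    inner ℝ (starMk L f) (starMk L g) = ∑ j, ∫ x in (0 : ℝ)..L, f j x * g j x := by
  rw [PiLp.inner_apply]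
  exact Finset.sum_congr rfl fun j _ => inner_edgeMk_edgeMk hL _ _

/-- The inclusion of the space of one edge into the space of the star. -/
noncomputable def starSingle (N : ℕ) (L : ℝ) (j : Fin N) : EdgeL2 L →L[ℝ] StarL2 N L :=
  (PiLp.continuousLinearEquiv 2 ℝ fun _ : Fin N => EdgeL2 L).symm.toContinuousLinearMap ∘L
    ContinuousLinearMap.single ℝ (fun _ : Fin N => EdgeL2 L) j

theorem starSingle_apply (N : ℕ) (L : ℝ) (i j : Fin N) (f : EdgeL2 L) :
    starSingle N L j f i = if i = j then f else 0 := by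
  simp [starSingle]

/-- The function equal to the coordinate `x` on every edge. -/
noncomputable def starId (N : ℕ) (L : ℝ) : StarL2 N L := starMk L fun _ => ContinuousMap.id ℝ

/-- The bounded inverse of the operator `A`.  It solves the Dirichlet problem on every edge, and
adds the multiple of the coordinate function for which the condition on the derivatives at the
internal vertex holds.  It is an inverse only if the sum of the conductivities is not zero. -/
noncomputable def starInverse (N D : ℕ) (k L : ℝ) (hL : 0 < L) : StarL2 N L →L[ℝ] StarL2 N L :=
  (∑ j, starSingle N L j ∘L ((conductivity N D k j)⁻¹ • greenOp L hL) ∘L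
    PiLp.proj 2 (fun _ : Fin N => EdgeL2 L) j) +
  (L * ∑ j, conductivity N D k j)⁻¹ • (innerSL ℝ (starId N L)).smulRight (starId N L)

theorem starInverse_apply (N D : ℕ) (k L : ℝ) (hL : 0 < L) (η : StarL2 N L) (i : Fin N) :
    starInverse N D k L hL η i = (conductivity N D k i)⁻¹ • greenOp L hL (η i) +
      ((L * ∑ j, conductivity N D k j)⁻¹ * inner ℝ (starId N L) η) •
        edgeMk L (ContinuousMap.id ℝ) := by
  simp [starInverse, starSingle_apply, smul_smul, starId, starMk_apply]

theorem isCompactOperator_starInverse (N D : ℕ) (k L : ℝ) (hL : 0 < L) :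
    IsCompactOperator (starInverse N D k L hL) := by
  have h1 : ∀ j : Fin N, (starSingle N L j ∘L ((conductivity N D k j)⁻¹ • greenOp L hL) ∘L
      PiLp.proj 2 (fun _ : Fin N => EdgeL2 L) j) ∈
        compactOperator (RingHom.id ℝ) (StarL2 N L) (StarL2 N L) := fun j => by
    have h := (isCompactOperator_kernelOp (greenSection L hL)).smul (conductivity N D k j)⁻¹
    exact (h.comp_clm (PiLp.proj 2 (fun _ : Fin N => EdgeL2 L) j)).clm_comp (starSingle N L j)
  refine Submodule.add_mem _ (Submodule.sum_mem _ fun j _ => h1 j) (Submodule.smul_mem _ _ ?_)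
  exact (isCompactOperator_of_locallyCompactSpace_rng
    (ContinuousLinearMap.toSpanSingleton ℝ (starId N L))).comp_clm (innerSL ℝ (starId N L))

theorem starInverse_isSymmetric (N D : ℕ) (k L : ℝ) (hL : 0 < L) :
    (starInverse N D k L hL : StarL2 N L →ₗ[ℝ] StarL2 N L).IsSymmetric := by
  have hid : ∀ ψ : StarL2 N L, inner ℝ (starId N L) ψ =
      ∑ i, inner ℝ (edgeMk L (ContinuousMap.id ℝ)) (ψ i) := fun ψ => PiLp.inner_apply _ _
  intro η ζ
  rw [ContinuousLinearMap.coe_coe, PiLp.inner_apply, PiLp.inner_apply]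
  simp only [starInverse_apply, inner_add_left, inner_add_right, real_inner_smul_left,
    real_inner_smul_right, Finset.sum_add_distrib, greenOp_symm]
  congr 1
  simp only [← Finset.mul_sum, real_inner_comm (edgeMk L (ContinuousMap.id ℝ)), ← hid]
  ring

theorem starInverse_classical {N D : ℕ} {k L : ℝ} (hL : 0 < L)
    (hk : ∀ j, conductivity N D k j ≠ 0) (hσ : ∑ j, conductivity N D k j ≠ 0)
    {u : Fin N → C(ℝ, ℝ)} {v : Fin N → ℝ → ℝ} {w : Fin N → C(ℝ, ℝ)}
    (h : IsClassicalDomain N D k L u v w) :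
    starInverse N D k L hL (starMk L fun j => -(conductivity N D k j • w j)) = starMk L u := by
  refine PiLp.ext fun j => ?_
  have hid : inner ℝ (starId N L) (starMk L fun j => -(conductivity N D k j • w j)) =
      (∑ i, conductivity N D k i) * u j L := by
    rw [starId, inner_starMk hL.le, Finset.sum_mul]
    have : ∀ i, ∫ x in (0 : ℝ)..L, (ContinuousMap.id ℝ) x * (-(conductivity N D k i • w i)) x =
        conductivity N D k i * u j L - L * (conductivity N D k i * v i L) := by
      intro i
      have := integral_id_mul_deriv_deriv (L := L) (u := fun x => -(conductivity N D k i * u i x))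
        (v := fun x => -(conductivity N D k i * v i x)) (w := -(conductivity N D k i • w i))
        (fun x => ((h.hasDerivAt_fst i x).const_mul _).neg)
        (fun x => ((h.hasDerivAt_snd i x).const_mul _).neg) (by simp [h.external])
      refine this.trans ?_
      rw [h.continuity i j]
      ring
    rw [Finset.sum_congr rfl fun i _ => this i, Finset.sum_sub_distrib, ← Finset.mul_sum,
      h.kirchhoff, mul_zero, sub_zero]
  rw [starInverse_apply, hid, starMk_apply, starMk_apply, greenOp, kernelOp_apply, ← edgeMk_smul,
    ← edgeMk_smul, ← edgeMk_add]
  refine edgeMk_congr fun x hx => ?_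
  have := inner_greenSection hL (u := fun x => -(conductivity N D k j * u j x))
    (v := fun x => -(conductivity N D k j * v j x)) (w := -(conductivity N D k j • w j))
    (fun x => ((h.hasDerivAt_fst j x).const_mul _).neg)
    (fun x => ((h.hasDerivAt_snd j x).const_mul _).neg) (by simp [h.external]) hx
  have hkj := hk j
  simp only [ContinuousMap.add_apply, ContinuousMap.smul_apply, smul_eq_mul, this,
    ContinuousMap.id_apply]
  field_simp
  ring

/-- The range of the inverse contains the test functions, so its kernel is orthogonal to them. -/
theorem starInverse_injective {N D : ℕ} {k L : ℝ} (hL : 0 < L)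
    (hk : ∀ j, conductivity N D k j ≠ 0) (hσ : ∑ j, conductivity N D k j ≠ 0) {η : StarL2 N L}
    (h0 : starInverse N D k L hL η = 0) : η = 0 := by
  refine PiLp.ext fun j => ?_
  have hloc : LocallyIntegrableOn (η j) (Ioo 0 L) (edgeMeasure L) :=
    ((Lp.memLp (η j)).integrable one_le_two).locallyIntegrable.locallyIntegrableOn _
  have hae := isOpen_Ioo.ae_eq_zero_of_integral_contDiff_smul_eq_zero hloc
    (fun φ hφ _ hsupp => by
      have hd : ContDiff ℝ ∞ (deriv φ) := (contDiff_infty_iff_deriv.1 hφ).2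
      have hdd : ContDiff ℝ ∞ (deriv (deriv φ)) := (contDiff_infty_iff_deriv.1 hd).2
      have hL0 : L ∉ tsupport φ := fun h => lt_irrefl _ (hsupp h).2
      have h00 : (0 : ℝ) ∉ tsupport φ := fun h => lt_irrefl _ (hsupp h).1
      have hdL : deriv φ L = 0 :=
        image_eq_zero_of_notMem_tsupport fun h => hL0 (tsupport_deriv_subset h)
      have hcl : IsClassicalDomain N D k L (fun i => if i = j then ⟨φ, hφ.continuous⟩ else 0)
          (fun i => if i = j then deriv φ else 0)
          (fun i => if i = j then ⟨deriv (deriv φ), hdd.continuous⟩ else 0) := by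
        refine ⟨fun i x => ?_, fun i x => ?_, fun i => ?_, fun i i' => ?_, ?_⟩
        · split_ifs
          · exact (hφ.differentiable (by simp) x).hasDerivAt
          · exact hasDerivAt_const x 0
        · split_ifs
          · exact (hd.differentiable (by simp) x).hasDerivAt
          · exact hasDerivAt_const x 0
        · split_ifs
          · exact image_eq_zero_of_notMem_tsupport h00
          · rfl
        · have : ∀ i : Fin N, (if i = j then (⟨φ, hφ.continuous⟩ : C(ℝ, ℝ)) else 0) L = 0 := by
            intro i
            split_ifs
            · exact image_eq_zero_of_notMem_tsupport hL0
            · rfl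
          rw [this, this]
        · refine Finset.sum_eq_zero fun i _ => ?_
          split_ifs
          · rw [hdL, mul_zero]
          · simp
      have h1 := starInverse_isSymmetric N D k L hL η
        (starMk L fun i => -(conductivity N D k i • if i = j then
          (⟨deriv (deriv φ), hdd.continuous⟩ : C(ℝ, ℝ)) else 0))
      rw [ContinuousLinearMap.coe_coe, starInverse_classical hL hk hσ hcl, h0, inner_zero_left,
        PiLp.inner_apply, Finset.sum_eq_single j] at h1
      · rw [starMk_apply, if_pos rfl, real_inner_comm, inner_edgeMk_left] at h1
        exact h1.symm
      · intro i _ hij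
        rw [starMk_apply, if_neg hij]
        exact inner_zero_right _
      · simp)
  refine Lp.ext ?_
  have hne : ∀ᵐ x ∂edgeMeasure L, x ≠ L := ae_restrict_of_ae (by simp [ae_iff])
  filter_upwards [hae, ae_restrict_mem measurableSet_Ioc, hne,
    Lp.coeFn_zero ℝ 2 (edgeMeasure L)] with x hx hx1 hx2 hx3
  rw [hx ⟨hx1.1, lt_of_le_of_ne hx1.2 hx2⟩]
  exact hx3.symm

/-! ### Classical eigenfunctions -/

theorem hasWeakDeriv_of_hasDerivAt {L : ℝ} {f g : ℝ → ℝ}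
    (hf : ∀ x, HasDerivAt f (g x) x) (hg : Continuous g) : HasWeakDeriv L f g := by
  intro φ hφ _ hsupp
  have hL0 : φ L = 0 := image_eq_zero_of_notMem_tsupport fun h => lt_irrefl _ (hsupp h).2
  have h00 : φ 0 = 0 := image_eq_zero_of_notMem_tsupport fun h => lt_irrefl _ (hsupp h).1
  have hd : Continuous (deriv φ) := (contDiff_infty_iff_deriv.1 hφ).2.continuous
  rw [intervalIntegral.integral_mul_deriv_eq_deriv_mul (fun x _ => hf x)
    (fun x _ => (hφ.differentiable (by simp) x).hasDerivAt) (hg.intervalIntegrable _ _)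
    (hd.intervalIntegrable _ _), hL0, h00]
  ring

theorem IsClassicalDomain.isStarOperator {N D : ℕ} {k L : ℝ} (hL : 0 < L)
    {u : Fin N → C(ℝ, ℝ)} {v : Fin N → ℝ → ℝ} {w : Fin N → C(ℝ, ℝ)}
    (h : IsClassicalDomain N D k L u v w) :
    IsStarOperator N D k L (starMk L u) (starMk L fun j => -(conductivity N D k j • w j)) := by
  have hv : ∀ j, Continuous (v j) := fun j =>
    continuous_iff_continuousAt.2 fun x => (h.hasDerivAt_snd j x).continuousAt
  refine ⟨fun j => u j, v, fun j => edgeMk L (w j), fun j => ?_, h.external, h.continuity,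
    h.kirchhoff, fun j => rfl⟩
  refine ⟨(u j).continuous.continuousOn, (hv j).continuousOn, edgeMk_coeFn L (u j),
    hasWeakDeriv_of_hasDerivAt (h.hasDerivAt_fst j) (hv j), fun φ hφ hc hsupp => ?_⟩
  rw [hasWeakDeriv_of_hasDerivAt (h.hasDerivAt_snd j) (w j).continuous φ hφ hc hsupp]
  congr 1
  rw [intervalIntegral.integral_of_le hL.le, intervalIntegral.integral_of_le hL.le]
  refine integral_congr_ae ?_
  filter_upwards [edgeMk_coeFn L (w j)] with x hx
  rw [hx]

/-- A function in the classical domain with `-k_j u_j'' = ev u_j` on every edge. -/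
def IsClassicalEigen (N D : ℕ) (k L ev : ℝ) (u : Fin N → C(ℝ, ℝ)) (v : Fin N → ℝ → ℝ) : Prop :=
  IsClassicalDomain N D k L u v fun j => -((ev / conductivity N D k j) • u j)

theorem IsClassicalEigen.smul {N D : ℕ} {k L ev : ℝ} {u : Fin N → C(ℝ, ℝ)} {v : Fin N → ℝ → ℝ}
    (h : IsClassicalEigen N D k L ev u v) (c : ℝ) :
    IsClassicalEigen N D k L ev (c • u) (c • v) where
  hasDerivAt_fst j x := (h.hasDerivAt_fst j x).const_mul c
  hasDerivAt_snd j x := ((h.hasDerivAt_snd j x).const_mul c).congr_deriv (by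
    simp only [ContinuousMap.neg_apply, ContinuousMap.smul_apply, smul_eq_mul, Pi.smul_apply]
    ring)
  external j := by simp [h.external]
  continuity i j := by simp [h.continuity i j]
  kirchhoff := by
    have := h.kirchhoff
    simp only [Pi.smul_apply, smul_eq_mul, mul_left_comm _ c, ← Finset.mul_sum, this, mul_zero]

theorem starMk_neg_conductivity_smul {N D : ℕ} {k ev : ℝ} (L : ℝ)
    (hk : ∀ j, conductivity N D k j ≠ 0) (u : Fin N → C(ℝ, ℝ)) :
    (starMk L fun j => -(conductivity N D k j • -((ev / conductivity N D k j) • u j))) =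
      ev • starMk L u := by
  rw [← starMk_smul]
  congr 1
  ext j x
  have := hk j
  simp only [ContinuousMap.neg_apply, ContinuousMap.smul_apply, smul_eq_mul, Pi.smul_apply]
  field_simp

theorem IsClassicalEigen.isStarEigenfunction {N D : ℕ} {k L ev : ℝ} (hL : 0 < L)
    (hk : ∀ j, conductivity N D k j ≠ 0) {u : Fin N → C(ℝ, ℝ)} {v : Fin N → ℝ → ℝ}
    (h : IsClassicalEigen N D k L ev u v) (hu : starMk L u ≠ 0) :
    IsStarEigenfunction N D k L ev (normalized (starMk L u)) := by
  refine ⟨smul_ne_zero (inv_ne_zero (norm_ne_zero_iff.2 hu)) hu, ?_⟩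
  have := IsClassicalDomain.isStarOperator hL (h.smul ‖starMk L u‖⁻¹)
  rwa [starMk_neg_conductivity_smul L hk] at this

theorem IsClassicalEigen.starInverse_eq {N D : ℕ} {k L ev : ℝ} (hL : 0 < L)
    (hk : ∀ j, conductivity N D k j ≠ 0) (hσ : ∑ j, conductivity N D k j ≠ 0) (hev : ev ≠ 0)
    {u : Fin N → C(ℝ, ℝ)} {v : Fin N → ℝ → ℝ} (h : IsClassicalEigen N D k L ev u v) :
    starInverse N D k L hL (starMk L u) = ev⁻¹ • starMk L u := by
  have := starInverse_classical hL hk hσ h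
  rw [starMk_neg_conductivity_smul L hk, map_smul] at this
  rw [eq_inv_smul_iff₀ hev, this]

/-! ### The modes are eigenfunctions -/

theorem conductivity_of_lt {N D : ℕ} (k : ℝ) {j : Fin N} (hj : j.val < D) :
    conductivity N D k j = 1 := if_pos hj

theorem conductivity_of_not_lt {N D : ℕ} (k : ℝ) {j : Fin N} (hj : ¬ j.val < D) :
    conductivity N D k j = k := if_neg hj

theorem conductivity_ne_zero {N D : ℕ} {k : ℝ} (hk : k < 0) (j : Fin N) :
    conductivity N D k j ≠ 0 := by
  unfold conductivity
  split_ifs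
  · exact one_ne_zero
  · exact hk.ne

theorem sum_phases {N D : ℕ} (hDN : D ≤ N) (a b : ℝ) :
    ∑ j : Fin N, (if j.val < D then a else b) = D * a + ((N : ℝ) - D) * b := by
  have h1 : ∑ j : Fin N, (if j.val < D then a else b) =
      ∑ i ∈ Finset.range N, if i < D then a else b :=
    Fin.sum_univ_eq_sum_range (fun i => if i < D then a else b) N
  rw [h1, ← Finset.sum_range_add_sum_Ico _ hDN,
    Finset.sum_congr rfl fun i hi => if_pos (Finset.mem_range.1 hi),
    Finset.sum_congr (s₁ := Finset.Ico D N) rfl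
      fun i hi => if_neg (not_lt.2 (Finset.mem_Ico.1 hi).1)]
  simp [Nat.cast_sub hDN]

theorem sum_conductivity_ne_zero {N D : ℕ} {k : ℝ} (hDN : D < N) (hk : k < 0)
    (hres : |k| ≠ (D : ℝ) / ((N : ℝ) - D)) : ∑ j : Fin N, conductivity N D k j ≠ 0 := by
  have h1 : ∑ j : Fin N, conductivity N D k j = D * 1 + ((N : ℝ) - D) * k :=
    sum_phases hDN.le 1 k
  have h2 : (0 : ℝ) < (N : ℝ) - D := sub_pos.2 (by exact_mod_cast hDN)
  rw [h1]
  intro h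
  apply hres
  rw [abs_of_neg hk, eq_div_iff h2.ne']
  linarith

theorem hasDerivAt_sin_mul (r x : ℝ) :
    HasDerivAt (fun x => Real.sin (r * x)) (r * Real.cos (r * x)) x := by
  have hlin : HasDerivAt (fun x : ℝ => r * x) r x := by
    simpa using (hasDerivAt_id x).const_mul r
  exact hlin.sin.congr_deriv (mul_comm _ _)

theorem hasDerivAt_cos_mul (r x : ℝ) :
    HasDerivAt (fun x => Real.cos (r * x)) (-(r * Real.sin (r * x))) x := by
  have hlin : HasDerivAt (fun x : ℝ => r * x) r x := by
    simpa using (hasDerivAt_id x).const_mul r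
  exact hlin.cos.congr_deriv (by ring)

theorem hasDerivAt_sinh_mul (r x : ℝ) :
    HasDerivAt (fun x => Real.sinh (r * x)) (r * Real.cosh (r * x)) x := by
  have hlin : HasDerivAt (fun x : ℝ => r * x) r x := by
    simpa using (hasDerivAt_id x).const_mul r
  exact hlin.sinh.congr_deriv (mul_comm _ _)

theorem hasDerivAt_cosh_mul (r x : ℝ) :
    HasDerivAt (fun x => Real.cosh (r * x)) (r * Real.sinh (r * x)) x := by
  have hlin : HasDerivAt (fun x : ℝ => r * x) r x := by
    simpa using (hasDerivAt_id x).const_mul r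
  exact hlin.cosh.congr_deriv (mul_comm _ _)

theorem sqrt_abs_pos {k : ℝ} (hk : k < 0) : 0 < √|k| := Real.sqrt_pos.2 (abs_pos.2 hk.ne)

theorem sq_sqrt_abs {k : ℝ} (hk : k < 0) : √|k| ^ 2 = -k := by
  rw [Real.sq_sqrt (abs_nonneg k), abs_of_neg hk]

/-- A sine mode is an eigenfunction if its coefficients have zero sum and live on edges of one and
the same conductivity. -/
theorem isClassicalEigen_sine {N D : ℕ} {k L κ : ℝ} (hL : 0 < L)
    (hk : ∀ j, conductivity N D k j ≠ 0) {c : Fin N → ℝ}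
    (hκ : ∀ j, c j ≠ 0 → conductivity N D k j = κ) (hc : ∑ j, c j = 0) (n : ℕ) :
    IsClassicalEigen N D k L (κ * (n * Real.pi / L) ^ 2)
      (fun j => ⟨fun x => c j * Real.sin (n * Real.pi * x / L), by fun_prop⟩)
      (fun j x => c j * (n * Real.pi / L * Real.cos (n * Real.pi / L * x))) where
  hasDerivAt_fst j x := by
    simpa [mul_div_right_comm] using (hasDerivAt_sin_mul (n * Real.pi / L) x).const_mul (c j)
  hasDerivAt_snd j x := by
    refine (((hasDerivAt_cos_mul (n * Real.pi / L) x).const_mul _).const_mul (c j)).congr_deriv ?_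
    simp only [ContinuousMap.neg_apply, ContinuousMap.smul_apply, smul_eq_mul,
      ContinuousMap.coe_mk, mul_div_right_comm _ x L]
    by_cases h : c j = 0
    · simp [h]
    · rw [← hκ j h, mul_div_cancel_left₀ _ (hk j)]
      ring
  external j := by simp
  continuity i j := by
    have : (n : ℝ) * Real.pi * L / L = n * Real.pi := by field_simp
    simp [this, Real.sin_nat_mul_pi]
  kirchhoff := by
    have : ∀ j, conductivity N D k j * (c j * (n * Real.pi / L * Real.cos (n * Real.pi / L * L))) =
        c j * (κ * (n * Real.pi / L * Real.cos (n * Real.pi / L * L))) := by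
      intro j
      by_cases h : c j = 0
      · simp [h]
      · rw [hκ j h]
        ring
    rw [Finset.sum_congr rfl fun j _ => this j, ← Finset.sum_mul, hc, zero_mul]

theorem cos_ne_zero_of_tan_ne_zero {a : ℝ} (h : Real.tan a ≠ 0) : Real.cos a ≠ 0 := fun h' =>
  h (by rw [Real.tan_eq_sin_div_cos, h', div_zero])

theorem IsDispersionRootA.tan_pos {N D : ℕ} {k a : ℝ} (hD : 1 ≤ D) (hDN : D < N) (hk : k < 0)
    (ha : IsDispersionRootA N D k a) : 0 < Real.tan a := by
  have hs := sqrt_abs_pos hk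
  have h1 : (0 : ℝ) < D := by exact_mod_cast hD
  have h2 : (0 : ℝ) < (N : ℝ) - D := sub_pos.2 (by exact_mod_cast hDN)
  have h3 := Real.sinh_pos_iff.2 (mul_pos hs ha.1)
  have h4 := Real.cosh_pos (√|k| * a)
  rw [ha.2, Real.tanh_eq_sinh_div_cosh]
  positivity

theorem IsDispersionRootB.tan_pos {N D : ℕ} {k b : ℝ} (hD : 1 ≤ D) (hDN : D < N) (hk : k < 0)
    (hb : IsDispersionRootB N D k b) : 0 < Real.tan b := by
  have hs := sqrt_abs_pos hk
  have h1 : (0 : ℝ) < D := by exact_mod_cast hD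
  have h2 : (0 : ℝ) < (N : ℝ) - D := sub_pos.2 (by exact_mod_cast hDN)
  have h3 := Real.sinh_pos_iff.2 (div_pos hb.1 hs)
  have h4 := Real.cosh_pos (b / √|k|)
  rw [hb.2, Real.tanh_eq_sinh_div_cosh]
  positivity

theorem isClassicalEigen_mixedA {N D : ℕ} {k L a : ℝ} (hD : 1 ≤ D) (hDN : D < N) (hk : k < 0)
    (hL : 0 < L) (ha : IsDispersionRootA N D k a) :
    IsClassicalEigen N D k L (k * (a / L) ^ 2)
      (fun j => if j.val < D then
        ⟨fun x => Real.sin a / Real.sinh (√|k| * a) * Real.sinh (√|k| * a * x / L), by fun_prop⟩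
        else ⟨fun x => Real.sin (a * x / L), by fun_prop⟩)
      (fun j => if j.val < D then
        fun x => Real.sin a / Real.sinh (√|k| * a) *
          (√|k| * a / L * Real.cosh (√|k| * a / L * x))
        else fun x => a / L * Real.cos (a / L * x)) := by
  have hs := sqrt_abs_pos hk
  have hs2 := sq_sqrt_abs hk
  have hsinh := (Real.sinh_pos_iff.2 (mul_pos hs ha.1)).ne'
  have e1 : √|k| * a / L * L = √|k| * a := by field_simp
  have e2 : a / L * L = a := by field_simp
  refine ⟨fun j x => ?_, fun j x => ?_, fun j => ?_, ?_, ?_⟩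
  · split_ifs
    · simpa [mul_div_right_comm _ _ L] using
        (hasDerivAt_sinh_mul (√|k| * a / L) x).const_mul (Real.sin a / Real.sinh (√|k| * a))
    · simpa [mul_div_right_comm _ _ L] using hasDerivAt_sin_mul (a / L) x
  · by_cases hj : j.val < D
    · simp only [hj, if_true, conductivity_of_lt k hj]
      refine (((hasDerivAt_cosh_mul (√|k| * a / L) x).const_mul _).const_mul
        (Real.sin a / Real.sinh (√|k| * a))).congr_deriv ?_
      simp only [ContinuousMap.neg_apply, ContinuousMap.smul_apply, smul_eq_mul,
        ContinuousMap.coe_mk, mul_div_right_comm _ x L]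
      rw [show k = -√|k| ^ 2 by rw [hs2, neg_neg], abs_neg, abs_of_nonneg (sq_nonneg (√|k|)),
        Real.sqrt_sq hs.le]
      ring
    · simp only [hj, if_false, conductivity_of_not_lt k hj]
      refine ((hasDerivAt_cos_mul (a / L) x).const_mul _).congr_deriv ?_
      simp only [ContinuousMap.neg_apply, ContinuousMap.smul_apply, smul_eq_mul,
        ContinuousMap.coe_mk, mul_div_right_comm _ x L]
      rw [mul_div_cancel_left₀ _ hk.ne]
      ring
  · split_ifs <;> simp
  · have : ∀ j : Fin N, (if j.val < D then
        (⟨fun x => Real.sin a / Real.sinh (√|k| * a) * Real.sinh (√|k| * a * x / L),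
          by fun_prop⟩ : C(ℝ, ℝ))
        else ⟨fun x => Real.sin (a * x / L), by fun_prop⟩) L = Real.sin a := by
      intro j
      split_ifs
      · simp [mul_div_assoc, hL.ne', hsinh]
      · simp [mul_div_assoc, hL.ne']
    intro i j
    rw [this, this]
  · have : ∀ j : Fin N, conductivity N D k j * (if j.val < D then
        fun x => Real.sin a / Real.sinh (√|k| * a) *
          (√|k| * a / L * Real.cosh (√|k| * a / L * x))
        else fun x => a / L * Real.cos (a / L * x)) L =
        if j.val < D then Real.sin a / Real.sinh (√|k| * a) *
          (√|k| * a / L * Real.cosh (√|k| * a)) else k * (a / L * Real.cos a) := by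
      intro j
      by_cases hj : j.val < D
      · simp only [hj, if_true, conductivity_of_lt k hj, e1, one_mul]
      · simp only [hj, if_false, conductivity_of_not_lt k hj, e2]
    rw [Finset.sum_congr rfl fun j _ => this j, sum_phases hDN.le]
    have hcos := cos_ne_zero_of_tan_ne_zero (ha.tan_pos hD hDN hk).ne'
    have h1 := ha.2
    have h2 := (Real.cosh_pos (√|k| * a)).ne'
    have h3 : (D : ℝ) ≠ 0 := by exact_mod_cast (by omega : D ≠ 0)
    have hL' := hL.ne'
    rw [Real.tanh_eq_sinh_div_cosh, Real.tan_eq_sin_div_cos] at h1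
    field_simp at h1 ⊢
    linear_combination (a * √|k|) * h1 +
      (a * ((N : ℝ) - D) * Real.cos a * Real.sinh (√|k| * a)) * hs2

theorem isClassicalEigen_mixedB {N D : ℕ} {k L b : ℝ} (hD : 1 ≤ D) (hDN : D < N) (hk : k < 0)
    (hL : 0 < L) (hb : IsDispersionRootB N D k b) :
    IsClassicalEigen N D k L ((b / L) ^ 2)
      (fun j => if j.val < D then ⟨fun x => Real.sin (b * x / L), by fun_prop⟩
        else ⟨fun x => Real.sin b / Real.sinh (b / √|k|) * Real.sinh (b / √|k| * x / L),
          by fun_prop⟩)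
      (fun j => if j.val < D then fun x => b / L * Real.cos (b / L * x)
        else fun x => Real.sin b / Real.sinh (b / √|k|) *
          (b / √|k| / L * Real.cosh (b / √|k| / L * x))) := by
  have hs := sqrt_abs_pos hk
  have hs2 := sq_sqrt_abs hk
  have hsinh := (Real.sinh_pos_iff.2 (div_pos hb.1 hs)).ne'
  have e1 : b / √|k| / L * L = b / √|k| := by field_simp
  have e2 : b / L * L = b := by field_simp
  refine ⟨fun j x => ?_, fun j x => ?_, fun j => ?_, ?_, ?_⟩
  · split_ifs
    · simpa [mul_div_right_comm _ _ L] using hasDerivAt_sin_mul (b / L) x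
    · simpa [mul_div_right_comm _ _ L] using
        (hasDerivAt_sinh_mul (b / √|k| / L) x).const_mul (Real.sin b / Real.sinh (b / √|k|))
  · by_cases hj : j.val < D
    · simp only [hj, if_true, conductivity_of_lt k hj]
      refine ((hasDerivAt_cos_mul (b / L) x).const_mul _).congr_deriv ?_
      simp only [ContinuousMap.neg_apply, ContinuousMap.smul_apply, smul_eq_mul,
        ContinuousMap.coe_mk, mul_div_right_comm _ x L]
      ring
    · simp only [hj, if_false, conductivity_of_not_lt k hj]
      refine (((hasDerivAt_cosh_mul (b / √|k| / L) x).const_mul _).const_mul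
        (Real.sin b / Real.sinh (b / √|k|))).congr_deriv ?_
      simp only [ContinuousMap.neg_apply, ContinuousMap.smul_apply, smul_eq_mul,
        ContinuousMap.coe_mk, mul_div_right_comm _ x L]
      have hq : (b / L) ^ 2 / k = -(b / √|k| / L) ^ 2 := by
        have := hk.ne
        rw [div_pow, div_pow, div_pow, hs2]
        field_simp
      rw [hq]
      ring
  · split_ifs <;> simp
  · have : ∀ j : Fin N, (if j.val < D then
        (⟨fun x => Real.sin (b * x / L), by fun_prop⟩ : C(ℝ, ℝ))
        else ⟨fun x => Real.sin b / Real.sinh (b / √|k|) * Real.sinh (b / √|k| * x / L),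
          by fun_prop⟩) L = Real.sin b := by
      intro j
      split_ifs
      · simp [mul_div_assoc, hL.ne']
      · simp only [ContinuousMap.coe_mk, mul_div_assoc _ L L, div_self hL.ne', mul_one]
        exact div_mul_cancel₀ _ hsinh
    intro i j
    rw [this, this]
  · have : ∀ j : Fin N, conductivity N D k j * (if j.val < D then
        fun x => b / L * Real.cos (b / L * x)
        else fun x => Real.sin b / Real.sinh (b / √|k|) *
          (b / √|k| / L * Real.cosh (b / √|k| / L * x))) L =
        if j.val < D then b / L * Real.cos b else k * (Real.sin b / Real.sinh (b / √|k|) *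
          (b / √|k| / L * Real.cosh (b / √|k|))) := by
      intro j
      by_cases hj : j.val < D
      · simp only [hj, if_true, conductivity_of_lt k hj, e2, one_mul]
      · simp only [hj, if_false, conductivity_of_not_lt k hj, e1]
    rw [Finset.sum_congr rfl fun j _ => this j, sum_phases hDN.le]
    have hcos := cos_ne_zero_of_tan_ne_zero (hb.tan_pos hD hDN hk).ne'
    have h1 := hb.2
    have h2 := (Real.cosh_pos (b / √|k|)).ne'
    have h3 : (N : ℝ) - D ≠ 0 := (sub_pos.2 (by exact_mod_cast hDN)).ne'
    have hL' := hL.ne'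
    rw [Real.tanh_eq_sinh_div_cosh, Real.tan_eq_sin_div_cos] at h1
    field_simp at h1 ⊢
    linear_combination (-b * √|k|) * h1 +
      (b * ((N : ℝ) - D) * Real.sin b * Real.cosh (b / √|k|)) * hs2

theorem starMk_ne_zero {N : ℕ} {L : ℝ} {f : Fin N → C(ℝ, ℝ)} {j : Fin N} {x : ℝ}
    (hx : x ∈ Ioo 0 L) (h : f j x ≠ 0) : starMk L f ≠ 0 := by
  intro h0
  have h1 : edgeMk L (f j) = 0 := by rw [← starMk_apply, h0]; rfl
  have h2 : f j =ᵐ[volume.restrict (Ioo 0 L)] (fun _ => (0 : ℝ)) := by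
    refine ae_restrict_of_ae_restrict_of_subset Ioo_subset_Ioc_self ?_
    filter_upwards [edgeMk_coeFn L (f j), Lp.coeFn_zero ℝ 2 (edgeMeasure L)] with y hy hy0
    rw [← hy, h1, hy0]
    rfl
  exact h (Measure.eqOn_open_of_ae_eq h2 isOpen_Ioo (f j).continuous.continuousOn
    continuousOn_const hx)

theorem exists_sin_ne_zero {L a : ℝ} (hL : 0 < L) (ha : 0 < a) :
    ∃ x ∈ Ioo 0 L, Real.sin (a * x / L) ≠ 0 := by
  -- at this point the argument of the sine is `a / (1 + a) < 1 < π`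
  refine ⟨L / (1 + a), ⟨by positivity, div_lt_self hL (by linarith)⟩, ?_⟩
  have : a * (L / (1 + a)) / L = a / (1 + a) := by field_simp
  rw [this]
  have h1 : a / (1 + a) < 1 := (div_lt_one (by positivity)).2 (by linarith)
  exact (Real.sin_pos_of_pos_of_lt_pi (by positivity) (by linarith [Real.pi_gt_three])).ne'

theorem sineMode_ne_zero {N : ℕ} {L : ℝ} (hL : 0 < L) {c : EuclideanSpace ℝ (Fin N)} (hc : c ≠ 0)
    (n : ℕ+) : sineMode L c n ≠ 0 := by
  obtain ⟨j, hj⟩ : ∃ j, c j ≠ 0 := by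
    by_contra! h
    exact hc (PiLp.ext h)
  have hn : (0 : ℝ) < n := by exact_mod_cast n.pos
  obtain ⟨x, hx, hx'⟩ := exists_sin_ne_zero hL (mul_pos hn Real.pi_pos)
  exact starMk_ne_zero (j := j) hx (mul_ne_zero hj hx')

theorem mixedModeA_ne_zero {N D : ℕ} (hDN : D < N) (k : ℝ) {L a : ℝ} (hL : 0 < L) (ha : 0 < a) :
    mixedModeA N D k L a ≠ 0 := by
  obtain ⟨x, hx, hx'⟩ := exists_sin_ne_zero hL ha
  refine starMk_ne_zero (j := ⟨D, hDN⟩) hx ?_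
  rwa [if_neg (lt_irrefl _)]

theorem mixedModeB_ne_zero {N D : ℕ} (hD : 1 ≤ D) (hDN : D < N) (k : ℝ) {L b : ℝ} (hL : 0 < L)
    (hb : 0 < b) : mixedModeB N D k L b ≠ 0 := by
  obtain ⟨x, hx, hx'⟩ := exists_sin_ne_zero hL hb
  refine starMk_ne_zero (j := ⟨0, by omega⟩) hx ?_
  rwa [if_pos (show 0 < D by omega)]

theorem basis_coe_ne_zero {N m : ℕ} {P : Set (Fin N)}
    (b : OrthonormalBasis (Fin m) ℝ (zeroSum N P)) (i : Fin m) :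
    (b i : EuclideanSpace ℝ (Fin N)) ≠ 0 := by
  intro h
  have h1 := b.norm_eq_one i
  rw [Submodule.coe_norm, h, norm_zero] at h1
  exact zero_ne_one h1

/-- Every mode is the normalization of a classical eigenfunction. -/
theorem exists_classical_mode {N D : ℕ} {k L : ℝ} (hD : 1 ≤ D) (hDN : D < N) (hk : k < 0)
    (hL : 0 < L)
    (α : ℕ+ → OrthonormalBasis (Fin (D - 1)) ℝ (zeroSum N (positivePhase N D)))
    (β : ℕ+ → OrthonormalBasis (Fin (N - D - 1)) ℝ (zeroSum N (negativePhase N D)))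
    (i : ModeIndex N D k) :
    ∃ (u : Fin N → C(ℝ, ℝ)) (v : Fin N → ℝ → ℝ),
      starMode N D k L α β i = normalized (starMk L u) ∧ starMk L u ≠ 0 ∧
      IsClassicalEigen N D k L (modeEigenvalue N D k L i) u v := by
  cases i with
  | sinePos n m =>
    have h := isClassicalEigen_sine (κ := 1) (k := k) (D := D) hL (conductivity_ne_zero hk)
      (c := fun j => (α n m : EuclideanSpace ℝ (Fin N)) j)
      (fun j hj => conductivity_of_lt k (by_contra fun h => hj ((α n m).2.1 j h)))
      (α n m).2.2 n
    rw [one_mul] at h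
    exact ⟨_, _, rfl, sineMode_ne_zero hL (basis_coe_ne_zero (α n) m) n, h⟩
  | sineNeg n m =>
    exact ⟨_, _, rfl, sineMode_ne_zero hL (basis_coe_ne_zero (β n) m) n,
      isClassicalEigen_sine hL (conductivity_ne_zero hk)
        (fun j hj => conductivity_of_not_lt k
          (not_lt.2 (by_contra fun h => hj ((β n m).2.1 j h))))
        (β n m).2.2 n⟩
  | mixedA a =>
    exact ⟨_, _, rfl, mixedModeA_ne_zero hDN k hL a.2.1, isClassicalEigen_mixedA hD hDN hk hL a.2⟩
  | mixedB b =>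
    exact ⟨_, _, rfl, mixedModeB_ne_zero hD hDN k hL b.2.1,
      isClassicalEigen_mixedB hD hDN hk hL b.2⟩

/-! ### Eigenvectors of the inverse -/

/-- If `y 0 = 0` and `y'' = q y` on `[0, L]`, then `y` is a multiple of the solution `S` with
`S 0 = 0`, `S' 0 = 1`.  The two constants of the motion are the Wronskians of `y` with `S` and with
`C = S'`. -/
theorem eq_mul_of_hasDerivAt_hasDerivAt {L q : ℝ} {y y' g S C : ℝ → ℝ}
    (hy : ∀ x, HasDerivAt y (y' x) x) (hy' : ∀ x, HasDerivAt y' (q * g x) x)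
    (hg : ∀ x ∈ Icc 0 L, g x = y x) (hy0 : y 0 = 0)
    (hS : ∀ x, HasDerivAt S (C x) x) (hC : ∀ x, HasDerivAt C (q * S x) x)
    (hS0 : S 0 = 0) (hC0 : C 0 = 1) {x : ℝ} (hx : x ∈ Icc 0 L) :
    y x = y' 0 * S x ∧ y' x = y' 0 * C x := by
  have hconst : ∀ f : ℝ → ℝ, (∀ x, ∃ c, HasDerivAt f c x ∧ (x ∈ Icc 0 L → c = 0)) →
      f x = f 0 := by
    intro f hf
    refine constant_of_has_deriv_right_zero (fun z _ => ?_) (fun z hz => ?_) x hx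
    · obtain ⟨c, hc, -⟩ := hf z
      exact hc.continuousAt.continuousWithinAt
    · obtain ⟨c, hc, hc0⟩ := hf z
      rw [← hc0 (Ico_subset_Icc_self hz)]
      exact hc.hasDerivWithinAt
  have h1 := hconst (fun x => C x * C x - q * (S x * S x)) fun x =>
    ⟨_, ((hC x).mul (hC x)).sub (((hS x).mul (hS x)).const_mul q), fun _ => by ring⟩
  have h2 := hconst (fun x => y' x * C x - q * (y x * S x)) fun x =>
    ⟨_, ((hy' x).mul (hC x)).sub (((hy x).mul (hS x)).const_mul q), fun hx => by
      rw [hg x hx]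
      ring⟩
  have h3 := hconst (fun x => y x * C x - y' x * S x) fun x =>
    ⟨_, ((hy x).mul (hC x)).sub ((hy' x).mul (hS x)), fun hx => by
      rw [hg x hx]
      ring⟩
  simp only [hS0, hC0, hy0, mul_zero, sub_zero, mul_one] at h1 h2 h3
  constructor
  · linear_combination (-y x) * h1 + S x * h2 + C x * h3
  · linear_combination (-y' x) * h1 + C x * h2 + q * S x * h3

/-- An eigenvector of the inverse for a nonzero eigenvalue `ev⁻¹` solves `-k_j u'' = ev u` on every
edge, vanishes at the external vertex, and satisfies the conditions at the internal vertex. -/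
theorem exists_coeff_of_starInverse_eq {N D : ℕ} {k L ev : ℝ} (hL : 0 < L)
    (hk : ∀ j, conductivity N D k j ≠ 0) (hσ : ∑ j, conductivity N D k j ≠ 0) (hev : ev ≠ 0)
    {η : StarL2 N L}
    (hη : starInverse N D k L hL η = ev⁻¹ • η)
    {S : Fin N → C(ℝ, ℝ)} {C : Fin N → ℝ → ℝ} (hS : ∀ j x, HasDerivAt (S j) (C j x) x)
    (hC : ∀ j x, HasDerivAt (C j) (-(ev / conductivity N D k j) * S j x) x)
    (hS0 : ∀ j, S j 0 = 0) (hC0 : ∀ j, C j 0 = 1) :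
    ∃ (d : Fin N → ℝ) (p : ℝ), η = starMk L (fun j => d j • S j) ∧ (∀ j, d j * S j L = p) ∧
      ∑ j, conductivity N D k j * (d j * C j L) = 0 := by
  set σ := ∑ j, conductivity N D k j with hσdef
  set c := (L * σ)⁻¹ * inner ℝ (starId N L) η with hc
  -- a continuous representative of `η`
  let y : Fin N → C(ℝ, ℝ) := fun j => ev • ((conductivity N D k j)⁻¹ •
    kernelFun (greenSection L hL) (η j) + c • ContinuousMap.id ℝ)
  have hηy : ∀ j, η j = edgeMk L (y j) := by
    intro j
    have h1 : η j = ev • starInverse N D k L hL η j := by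
      rw [hη, PiLp.smul_apply, smul_smul, mul_inv_cancel₀ hev, one_smul]
    rw [h1, starInverse_apply]
    rfl
  -- its double primitive
  let V : Fin N → ℝ → ℝ := fun j x => ∫ t in (0 : ℝ)..x, y j t
  have hV : ∀ j x, HasDerivAt (V j) (y j x) x := fun j x =>
    (y j).continuous.integral_hasStrictDerivAt 0 x |>.hasDerivAt
  have hVc : ∀ j, Continuous (V j) := fun j =>
    continuous_iff_continuousAt.2 fun x => (hV j x).continuousAt
  let U : Fin N → ℝ → ℝ := fun j x => ∫ t in (0 : ℝ)..x, V j t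
  have hU : ∀ j x, HasDerivAt (U j) (V j x) x := fun j x =>
    (hVc j).integral_hasStrictDerivAt 0 x |>.hasDerivAt
  have hU0 : ∀ j, U j 0 = 0 := fun j => intervalIntegral.integral_same
  -- the representative, written through the double primitive, is twice differentiable
  let z : Fin N → ℝ → ℝ := fun j x =>
    ev * ((conductivity N D k j)⁻¹ * (x * (U j L / L) - U j x) + c * x)
  let z' : Fin N → ℝ → ℝ := fun j x =>
    ev * ((conductivity N D k j)⁻¹ * (U j L / L - V j x) + c)
  have hlin : ∀ a x : ℝ, HasDerivAt (fun x : ℝ => x * a) a x := fun a x => by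
    simpa using (hasDerivAt_id x).mul_const a
  have hlin' : ∀ a x : ℝ, HasDerivAt (fun x : ℝ => a * x) a x := fun a x => by
    simpa using (hasDerivAt_id x).const_mul a
  have hz : ∀ j x, HasDerivAt (z j) (z' j x) x := fun j x =>
    ((((hlin _ x).sub (hU j x)).const_mul _).add (hlin' c x)).const_mul ev
  have hz' : ∀ j x, HasDerivAt (z' j) (-(ev / conductivity N D k j) * y j x) x := fun j x =>
    (((((hV j x).const_sub _).const_mul _).add_const c).const_mul ev).congr_deriv (by
      rw [div_eq_mul_inv]
      ring)
  have hyz : ∀ j, ∀ x ∈ Icc 0 L, y j x = z j x := by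
    intro j x hx
    have h1 := inner_greenSection hL (hU j) (hV j) (hU0 j) hx
    rw [← hηy] at h1
    simp only [y, z, ContinuousMap.smul_apply, ContinuousMap.add_apply, smul_eq_mul, h1,
      ContinuousMap.id_apply]
    ring
  have hsol : ∀ j, ∀ x ∈ Icc 0 L, z j x = z' j 0 * S j x ∧ z' j x = z' j 0 * C j x :=
    fun j x hx => eq_mul_of_hasDerivAt_hasDerivAt (hz j) (hz' j) (hyz j)
      (by simp [z, hU0]) (hS j) (hC j) (hS0 j) (hC0 j) hx
  have hLmem : L ∈ Icc 0 L := ⟨hL.le, le_rfl⟩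
  refine ⟨fun j => z' j 0, ev * (c * L), PiLp.ext fun j => ?_, fun j => ?_, ?_⟩
  · rw [hηy, starMk_apply]
    refine edgeMk_congr fun x hx => ?_
    rw [hyz j x hx, (hsol j x hx).1]
    rfl
  · rw [← (hsol j L hLmem).1]
    have := hL.ne'
    simp only [z]
    field_simp
    ring
  · have hinner : inner ℝ (starId N L) η = ∑ j, (L * V j L - U j L) := by
      have h1 : η = starMk L y := PiLp.ext fun j => hηy j
      rw [h1, starId, inner_starMk hL.le]
      exact Finset.sum_congr rfl fun j _ => integral_id_mul_deriv_deriv (hU j) (hV j) (hU0 j)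
    have hterm : ∀ j, conductivity N D k j * (z' j 0 * C j L) =
        ev * (conductivity N D k j * c - (L * V j L - U j L) / L) := by
      intro j
      have hkj := hk j
      rw [← (hsol j L hLmem).2]
      simp only [z']
      have := hL.ne'
      field_simp
      ring
    rw [Finset.sum_congr rfl fun j _ => hterm j, ← Finset.mul_sum, Finset.sum_sub_distrib,
      ← Finset.sum_mul, ← Finset.sum_div, ← hinner, hc]
    have := hL.ne'
    field_simp
    ring

/-! ### Orthogonality of sine modes -/

theorem inner_sineMode {N : ℕ} {L : ℝ} (hL : 0 ≤ L) (c d : EuclideanSpace ℝ (Fin N)) (n : ℕ+) :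
    inner ℝ (sineMode L c n) (sineMode L d n) =
      inner ℝ c d * ∫ x in (0 : ℝ)..L, Real.sin (n * Real.pi * x / L) ^ 2 := by
  rw [sineMode, sineMode, inner_starMk hL, PiLp.inner_apply, Finset.sum_mul]
  refine Finset.sum_congr rfl fun j _ => ?_
  rw [← intervalIntegral.integral_const_mul]
  refine intervalIntegral.integral_congr fun x _ => ?_
  simp only [ContinuousMap.coe_mk, Real.inner_apply]
  ring

theorem inner_normalized_sineMode {N m : ℕ} {L : ℝ} (hL : 0 ≤ L) {P : Set (Fin N)}
    (b : OrthonormalBasis (Fin m) ℝ (zeroSum N P)) {i i' : Fin m} (h : i ≠ i') (n : ℕ+) :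
    inner ℝ (normalized (sineMode L (b i : EuclideanSpace ℝ (Fin N)) n))
      (normalized (sineMode L (b i' : EuclideanSpace ℝ (Fin N)) n)) = 0 := by
  rw [normalized, normalized, real_inner_smul_left, real_inner_smul_right, inner_sineMode hL,
    ← Submodule.coe_inner, b.inner_eq_zero h]
  simp

theorem tan_nat_mul_pi_eq_zero (n : ℕ) : Real.tan (n * Real.pi) = 0 := by
  rw [Real.tan_eq_sin_div_cos, Real.sin_nat_mul_pi, zero_div]

/-! ### Completeness -/

theorem mem_of_normalized_mem {N : ℕ} {L : ℝ} {V : Submodule ℝ (StarL2 N L)} {ψ : StarL2 N L}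
    (h : normalized ψ ∈ V) : ψ ∈ V := by
  by_cases h0 : ψ = 0
  · rw [h0]
    exact V.zero_mem
  · have := V.smul_mem ‖ψ‖ h
    rwa [normalized, smul_smul, mul_inv_cancel₀ (norm_ne_zero_iff.2 h0), one_smul] at this

/-- `c ↦ sineMode L c n` as a linear map. -/
noncomputable def sineModeLin (N : ℕ) (L : ℝ) (n : ℕ+) :
    EuclideanSpace ℝ (Fin N) →ₗ[ℝ] StarL2 N L where
  toFun c := sineMode L c n
  map_add' c d := by
    refine PiLp.ext fun j => ?_
    rw [PiLp.add_apply, sineMode, sineMode, sineMode, starMk_apply, starMk_apply, starMk_apply,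
      ← edgeMk_add]
    congr 1
    ext x
    simp [add_mul]
  map_smul' r c := by
    rw [RingHom.id_apply, sineMode, sineMode, ← starMk_smul]
    congr 1
    ext j x
    simp [mul_assoc]

theorem sineMode_mem {N m : ℕ} {L : ℝ} {P : Set (Fin N)}
    (b : OrthonormalBasis (Fin m) ℝ (zeroSum N P)) {V : Submodule ℝ (StarL2 N L)} {n : ℕ+}
    (hV : ∀ i, sineMode L (b i : EuclideanSpace ℝ (Fin N)) n ∈ V)
    {c : EuclideanSpace ℝ (Fin N)} (hc : c ∈ zeroSum N P) : sineMode L c n ∈ V := by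
  have h1 : ∑ i, b.repr ⟨c, hc⟩ i • (b i : EuclideanSpace ℝ (Fin N)) = c := by
    have := congrArg (zeroSum N P).subtype (b.sum_repr ⟨c, hc⟩)
    rwa [map_sum] at this
  have h2 : sineModeLin N L n c = ∑ i, b.repr ⟨c, hc⟩ i • sineModeLin N L n (b i) := by
    conv_lhs => rw [← h1]
    simp only [map_sum, map_smul]
  change sineModeLin N L n c ∈ V
  rw [h2]
  exact V.sum_mem fun i _ => V.smul_mem _ (hV i)

theorem exists_eq_nat_mul_pi {b : ℝ} (hb : 0 < b) (h : Real.sin b = 0) :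
    ∃ n : ℕ+, b = n * Real.pi := by
  obtain ⟨z, hz⟩ := Real.sin_eq_zero_iff.1 h
  have hz0 : 0 < z := by
    have : (0 : ℝ) < z := pos_of_mul_pos_left (hz ▸ hb) Real.pi_pos.le
    exact_mod_cast this
  obtain ⟨n, rfl⟩ := Int.eq_ofNat_of_zero_le hz0.le
  refine ⟨⟨n, by exact_mod_cast hz0⟩, ?_⟩
  rw [← hz]
  simp

section Completeness

variable {N D : ℕ} {k L : ℝ}
  (α : ℕ+ → OrthonormalBasis (Fin (D - 1)) ℝ (zeroSum N (positivePhase N D)))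
  (β : ℕ+ → OrthonormalBasis (Fin (N - D - 1)) ℝ (zeroSum N (negativePhase N D)))

theorem sineMode_pos_mem_span {c : EuclideanSpace ℝ (Fin N)}
    (hc : c ∈ zeroSum N (positivePhase N D)) (n : ℕ+) :
    sineMode L c n ∈ Submodule.span ℝ (range (starMode N D k L α β)) :=
  sineMode_mem (α n) (fun m => mem_of_normalized_mem (by
    exact Submodule.subset_span ⟨ModeIndex.sinePos n m, rfl⟩)) hc

theorem sineMode_neg_mem_span {c : EuclideanSpace ℝ (Fin N)}
    (hc : c ∈ zeroSum N (negativePhase N D)) (n : ℕ+) :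
    sineMode L c n ∈ Submodule.span ℝ (range (starMode N D k L α β)) :=
  sineMode_mem (β n) (fun m => mem_of_normalized_mem (by
    exact Submodule.subset_span ⟨ModeIndex.sineNeg n m, rfl⟩)) hc

theorem mixedModeA_mem_span {a : ℝ} (ha : IsDispersionRootA N D k a) :
    mixedModeA N D k L a ∈ Submodule.span ℝ (range (starMode N D k L α β)) :=
  mem_of_normalized_mem (Submodule.subset_span ⟨ModeIndex.mixedA ⟨a, ha⟩, rfl⟩)

theorem mixedModeB_mem_span {b : ℝ} (hb : IsDispersionRootB N D k b) :
    mixedModeB N D k L b ∈ Submodule.span ℝ (range (starMode N D k L α β)) :=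
  mem_of_normalized_mem (Submodule.subset_span ⟨ModeIndex.mixedB ⟨b, hb⟩, rfl⟩)

/-- For a positive eigenvalue `r ^ 2` the solutions oscillate on the edges of conductivity `1`.  If
`sin (r L) = 0`, the value at the internal vertex is zero and a sine mode results; otherwise
the condition on the derivatives becomes the dispersion relation for `r L`. -/
theorem mem_span_of_eigenvalue_pos (hD : 1 ≤ D) (hDN : D < N) (hk : k < 0) (hL : 0 < L)
    (hσ : ∑ j, conductivity N D k j ≠ 0) {r : ℝ} (hr : 0 < r) {η : StarL2 N L}
    (hη : starInverse N D k L hL η = (r ^ 2)⁻¹ • η) :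
    η ∈ Submodule.span ℝ (range (starMode N D k L α β)) := by
  have hs := sqrt_abs_pos hk
  have hs2 := sq_sqrt_abs hk
  have hr0 := hr.ne'
  have hs0 := hs.ne'
  obtain ⟨d, p, hd, hp, hK⟩ := exists_coeff_of_starInverse_eq hL (conductivity_ne_zero hk) hσ
    (by positivity) hη
    (S := fun j => if j.val < D then ⟨fun x => r⁻¹ * Real.sin (r * x), by fun_prop⟩
      else ⟨fun x => (r / √|k|)⁻¹ * Real.sinh (r / √|k| * x), by fun_prop⟩)
    (C := fun j => if j.val < D then fun x => Real.cos (r * x)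
      else fun x => Real.cosh (r / √|k| * x))
    (fun j x => by
      split_ifs
      · exact ((hasDerivAt_sin_mul r x).const_mul _).congr_deriv (by field_simp)
      · exact ((hasDerivAt_sinh_mul _ x).const_mul _).congr_deriv (by field_simp))
    (fun j x => by
      by_cases hj : j.val < D
      · simp only [hj, if_true, conductivity_of_lt k hj]
        refine (hasDerivAt_cos_mul r x).congr_deriv ?_
        simp only [ContinuousMap.coe_mk]
        field_simp
      · simp only [hj, if_false, conductivity_of_not_lt k hj]
        refine (hasDerivAt_cosh_mul _ x).congr_deriv ?_
        have := hk.ne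
        simp only [ContinuousMap.coe_mk]
        field_simp
        rw [hs2]
        ring)
    (fun j => by split_ifs <;> simp) (fun j => by split_ifs <;> simp)
  set b := r * L with hb
  have hb0 : 0 < b := mul_pos hr hL
  have hbs : r / √|k| * L = b / √|k| := by rw [hb]; ring
  have hsinh : Real.sinh (b / √|k|) ≠ 0 := (Real.sinh_pos_iff.2 (div_pos hb0 hs)).ne'
  -- the common value `p` at the internal vertex fixes the amplitudes of the hyperbolic sines
  have hp1 : ∀ j : Fin N, j.val < D → d j * (r⁻¹ * Real.sin b) = p := fun j hj => by
    simpa only [hj, if_true, ContinuousMap.coe_mk] using hp j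
  have hp2 : ∀ j : Fin N, ¬ j.val < D → d j * ((r / √|k|)⁻¹ * Real.sinh (b / √|k|)) = p :=
    fun j hj => by
      have := hp j
      simpa only [hj, if_false, ContinuousMap.coe_mk, hbs] using this
  have hd2 : ∀ j : Fin N, ¬ j.val < D → d j = p * (r / √|k|) / Real.sinh (b / √|k|) :=
    fun j hj => by
      rw [← hp2 j hj]
      field_simp
  have hKterm : ∀ j : Fin N, conductivity N D k j * (d j * (if j.val < D then
      fun x => Real.cos (r * x) else fun x => Real.cosh (r / √|k| * x)) L) =
      if j.val < D then d j * Real.cos b else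
        k * (p * (r / √|k|) / Real.sinh (b / √|k|) * Real.cosh (b / √|k|)) := by
    intro j
    by_cases hj : j.val < D
    · simp only [hj, if_true, conductivity_of_lt k hj, one_mul, hb]
    · simp only [hj, if_false, conductivity_of_not_lt k hj, hbs, hd2 j hj]
  rw [Finset.sum_congr rfl fun j _ => hKterm j] at hK
  by_cases hsin : Real.sin b = 0
  · obtain ⟨n, hn⟩ := exists_eq_nat_mul_pi hb0 hsin
    have hp0 : p = 0 := by
      rw [← hp1 ⟨0, by omega⟩ (show 0 < D by omega), hsin, mul_zero, mul_zero]
    have hd0 : ∀ j : Fin N, ¬ j.val < D → d j = 0 := fun j hj => by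
      rw [hd2 j hj, hp0, zero_mul, zero_div]
    have hcos : Real.cos b ≠ 0 := fun h => by
      have := Real.sin_sq_add_cos_sq b
      rw [hsin, h] at this
      norm_num at this
    have hsum : ∑ j, d j = 0 := by
      have h1 : ∀ j : Fin N, (if j.val < D then d j * Real.cos b else
          k * (p * (r / √|k|) / Real.sinh (b / √|k|) * Real.cosh (b / √|k|))) =
          d j * Real.cos b := by
        intro j
        split_ifs with hj
        · rfl
        · rw [hp0, hd0 j hj]
          ring
      rw [Finset.sum_congr rfl fun j _ => h1 j, ← Finset.sum_mul] at hK
      exact (mul_eq_zero.1 hK).resolve_right hcos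
    have hη' : η = sineMode L (WithLp.toLp 2 fun j => d j * r⁻¹) n := by
      rw [hd, sineMode]
      congr 1
      ext j x
      have hrx : n * Real.pi * x / L = r * x := by
        rw [← hn, hb]
        field_simp
      by_cases hj : j.val < D
      · simp [hj, hrx, ← mul_assoc]
      · simp [hd0 j hj]
    rw [hη']
    refine sineMode_pos_mem_span α β ⟨fun j hj => ?_, ?_⟩ n
    · simp [hd0 j hj]
    · simp [← Finset.sum_mul, hsum]
  · have hd1 : ∀ j : Fin N, j.val < D → d j = p * r / Real.sin b := fun j hj => by
      rw [← hp1 j hj]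
      field_simp
    have hη' : η = (p / Real.sin b) • mixedModeB N D k L b := by
      rw [hd, mixedModeB, ← starMk_smul]
      congr 1
      ext j x
      have e1 : b * x / L = r * x := by
        rw [hb]
        field_simp
      have e2 : b / √|k| * x / L = r / √|k| * x := by
        rw [hb]
        field_simp
      by_cases hj : j.val < D
      · simp only [Pi.smul_apply, ContinuousMap.smul_apply, hj, if_true, ContinuousMap.coe_mk,
          smul_eq_mul, hd1 j hj, e1]
        field_simp
      · simp only [Pi.smul_apply, ContinuousMap.smul_apply, hj, if_false, ContinuousMap.coe_mk,
          smul_eq_mul, hd2 j hj, e2]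
        field_simp
    rw [hη']
    by_cases hp0 : p = 0
    · simp [hp0]
    refine Submodule.smul_mem _ _ (mixedModeB_mem_span α β ⟨hb0, ?_⟩)
    have h1 : ∀ j : Fin N, (if j.val < D then d j * Real.cos b else
        k * (p * (r / √|k|) / Real.sinh (b / √|k|) * Real.cosh (b / √|k|))) =
        if j.val < D then p * r / Real.sin b * Real.cos b else
        k * (p * (r / √|k|) / Real.sinh (b / √|k|) * Real.cosh (b / √|k|)) := by
      intro j
      split_ifs with hj
      · rw [hd1 j hj]
      · rfl
    rw [Finset.sum_congr rfl fun j _ => h1 j, sum_phases hDN.le] at hK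
    have hND : (N : ℝ) - D ≠ 0 := (sub_pos.2 (by exact_mod_cast hDN)).ne'
    have hcosh := (Real.cosh_pos (b / √|k|)).ne'
    have hrel : D * (Real.cos b * Real.sinh (b / √|k|)) =
        √|k| * ((N : ℝ) - D) * (Real.sin b * Real.cosh (b / √|k|)) := by
      have hk2 : k = -√|k| ^ 2 := by rw [hs2, neg_neg]
      rw [← mul_right_inj' (mul_ne_zero hp0 (mul_ne_zero hr0 hs0))]
      field_simp at hK
      linear_combination hK - (p * r * ((N : ℝ) - D) * Real.cosh (b / √|k|) * Real.sin b) * hs2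
    have hcos : Real.cos b ≠ 0 := fun h => by
      rw [h, zero_mul, mul_zero] at hrel
      exact mul_ne_zero (mul_ne_zero hs0 hND) (mul_ne_zero hsin hcosh) hrel.symm
    rw [Real.tan_eq_sin_div_cos, Real.tanh_eq_sinh_div_cosh]
    field_simp
    linear_combination -hrel

/-- For a negative eigenvalue `k r ^ 2` the two kinds of edges exchange their roles. -/
theorem mem_span_of_eigenvalue_neg (hD : 1 ≤ D) (hDN : D < N) (hk : k < 0) (hL : 0 < L)
    (hσ : ∑ j, conductivity N D k j ≠ 0) {r : ℝ} (hr : 0 < r) {η : StarL2 N L}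
    (hη : starInverse N D k L hL η = (k * r ^ 2)⁻¹ • η) :
    η ∈ Submodule.span ℝ (range (starMode N D k L α β)) := by
  have hs := sqrt_abs_pos hk
  have hs2 := sq_sqrt_abs hk
  have hr0 := hr.ne'
  have hs0 := hs.ne'
  obtain ⟨d, p, hd, hp, hK⟩ := exists_coeff_of_starInverse_eq hL (conductivity_ne_zero hk) hσ
    (mul_ne_zero hk.ne (by positivity)) hη
    (S := fun j => if j.val < D then ⟨fun x => (√|k| * r)⁻¹ * Real.sinh (√|k| * r * x), by fun_prop⟩
      else ⟨fun x => r⁻¹ * Real.sin (r * x), by fun_prop⟩)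
    (C := fun j => if j.val < D then fun x => Real.cosh (√|k| * r * x)
      else fun x => Real.cos (r * x))
    (fun j x => by
      split_ifs
      · exact ((hasDerivAt_sinh_mul _ x).const_mul _).congr_deriv (by field_simp)
      · exact ((hasDerivAt_sin_mul r x).const_mul _).congr_deriv (by field_simp))
    (fun j x => by
      by_cases hj : j.val < D
      · simp only [hj, if_true, conductivity_of_lt k hj]
        refine (hasDerivAt_cosh_mul _ x).congr_deriv ?_
        simp only [ContinuousMap.coe_mk]
        field_simp
        rw [hs2]
        ring
      · simp only [hj, if_false, conductivity_of_not_lt k hj]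
        refine (hasDerivAt_cos_mul r x).congr_deriv ?_
        have := hk.ne
        simp only [ContinuousMap.coe_mk]
        field_simp)
    (fun j => by split_ifs <;> simp) (fun j => by split_ifs <;> simp)
  set a := r * L with ha
  have ha0 : 0 < a := mul_pos hr hL
  have has : √|k| * r * L = √|k| * a := by rw [ha]; ring
  have hsinh : Real.sinh (√|k| * a) ≠ 0 := (Real.sinh_pos_iff.2 (mul_pos hs ha0)).ne'
  -- the common value `p` at the internal vertex fixes the amplitudes of the hyperbolic sines
  have hp1 : ∀ j : Fin N, ¬ j.val < D → d j * (r⁻¹ * Real.sin a) = p := fun j hj => by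
    simpa only [hj, if_false, ContinuousMap.coe_mk] using hp j
  have hp2 : ∀ j : Fin N, j.val < D → d j * ((√|k| * r)⁻¹ * Real.sinh (√|k| * a)) = p :=
    fun j hj => by
      have := hp j
      simpa only [hj, if_true, ContinuousMap.coe_mk, has] using this
  have hd2 : ∀ j : Fin N, j.val < D → d j = p * (√|k| * r) / Real.sinh (√|k| * a) :=
    fun j hj => by
      rw [← hp2 j hj]
      field_simp
  have hKterm : ∀ j : Fin N, conductivity N D k j * (d j * (if j.val < D then
      fun x => Real.cosh (√|k| * r * x) else fun x => Real.cos (r * x)) L) =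
      if j.val < D then p * (√|k| * r) / Real.sinh (√|k| * a) * Real.cosh (√|k| * a) else
        k * (d j * Real.cos a) := by
    intro j
    by_cases hj : j.val < D
    · simp only [hj, if_true, conductivity_of_lt k hj, one_mul, has, hd2 j hj]
    · simp only [hj, if_false, conductivity_of_not_lt k hj, ha]
  rw [Finset.sum_congr rfl fun j _ => hKterm j] at hK
  by_cases hsin : Real.sin a = 0
  · obtain ⟨n, hn⟩ := exists_eq_nat_mul_pi ha0 hsin
    have hp0 : p = 0 := by
      rw [← hp1 ⟨D, hDN⟩ (lt_irrefl D), hsin, mul_zero, mul_zero]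
    have hd0 : ∀ j : Fin N, j.val < D → d j = 0 := fun j hj => by
      rw [hd2 j hj, hp0, zero_mul, zero_div]
    have hcos : Real.cos a ≠ 0 := fun h => by
      have := Real.sin_sq_add_cos_sq a
      rw [hsin, h] at this
      norm_num at this
    have hsum : ∑ j, d j = 0 := by
      have h1 : ∀ j : Fin N, (if j.val < D then
          p * (√|k| * r) / Real.sinh (√|k| * a) * Real.cosh (√|k| * a) else
          k * (d j * Real.cos a)) = d j * (k * Real.cos a) := by
        intro j
        split_ifs with hj
        · rw [hp0, hd0 j hj]
          ring
        · ring
      rw [Finset.sum_congr rfl fun j _ => h1 j, ← Finset.sum_mul] at hK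
      exact (mul_eq_zero.1 hK).resolve_right (mul_ne_zero hk.ne hcos)
    have hη' : η = sineMode L (WithLp.toLp 2 fun j => d j * r⁻¹) n := by
      rw [hd, sineMode]
      congr 1
      ext j x
      have hrx : n * Real.pi * x / L = r * x := by
        rw [← hn, ha]
        field_simp
      by_cases hj : j.val < D
      · simp [hd0 j hj]
      · simp [hj, hrx, ← mul_assoc]
    rw [hη']
    refine sineMode_neg_mem_span α β ⟨fun j hj => ?_, ?_⟩ n
    · simp [hd0 j (not_le.1 hj)]
    · simp [← Finset.sum_mul, hsum]
  · have hd1 : ∀ j : Fin N, ¬ j.val < D → d j = p * r / Real.sin a := fun j hj => by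
      rw [← hp1 j hj]
      field_simp
    have hη' : η = (p / Real.sin a) • mixedModeA N D k L a := by
      rw [hd, mixedModeA, ← starMk_smul]
      congr 1
      ext j x
      have e1 : a * x / L = r * x := by
        rw [ha]
        field_simp
      have e2 : √|k| * a * x / L = √|k| * r * x := by
        rw [ha]
        field_simp
      by_cases hj : j.val < D
      · simp only [Pi.smul_apply, ContinuousMap.smul_apply, hj, if_true, ContinuousMap.coe_mk,
          smul_eq_mul, hd2 j hj, e2]
        field_simp
      · simp only [Pi.smul_apply, ContinuousMap.smul_apply, hj, if_false, ContinuousMap.coe_mk,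
          smul_eq_mul, hd1 j hj, e1]
        field_simp
    rw [hη']
    by_cases hp0 : p = 0
    · simp [hp0]
    refine Submodule.smul_mem _ _ (mixedModeA_mem_span α β ⟨ha0, ?_⟩)
    have h1 : ∀ j : Fin N, (if j.val < D then
        p * (√|k| * r) / Real.sinh (√|k| * a) * Real.cosh (√|k| * a) else
        k * (d j * Real.cos a)) =
        if j.val < D then p * (√|k| * r) / Real.sinh (√|k| * a) * Real.cosh (√|k| * a) else
        k * (p * r / Real.sin a * Real.cos a) := by
      intro j
      split_ifs with hj
      · rfl
      · rw [hd1 j hj]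
    rw [Finset.sum_congr rfl fun j _ => h1 j, sum_phases hDN.le] at hK
    have hD0 : (D : ℝ) ≠ 0 := by exact_mod_cast (by omega : D ≠ 0)
    have hcosh := (Real.cosh_pos (√|k| * a)).ne'
    have hrel : D * (Real.sin a * Real.cosh (√|k| * a)) =
        √|k| * ((N : ℝ) - D) * (Real.cos a * Real.sinh (√|k| * a)) := by
      rw [← mul_right_inj' (mul_ne_zero hp0 (mul_ne_zero hr0 hs0))]
      field_simp at hK
      linear_combination hK - (p * r * ((N : ℝ) - D) * Real.sinh (√|k| * a) * Real.cos a) * hs2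
    have hcos : Real.cos a ≠ 0 := fun h => by
      rw [h, zero_mul, mul_zero] at hrel
      exact mul_ne_zero hD0 (mul_ne_zero hsin hcosh) hrel
    rw [Real.tan_eq_sin_div_cos, Real.tanh_eq_sinh_div_cosh]
    field_simp
    linear_combination hrel

/-- The eigenspaces of the compact self-adjoint inverse have trivial orthogonal complement, and all
of them lie in the span of the modes. -/
theorem span_starMode_topologicalClosure (hD : 1 ≤ D) (hDN : D < N) (hk : k < 0) (hL : 0 < L)
    (hσ : ∑ j, conductivity N D k j ≠ 0) :
    (Submodule.span ℝ (range (starMode N D k L α β))).topologicalClosure = ⊤ := by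
  rw [Submodule.topologicalClosure_eq_top_iff, eq_bot_iff,
    ← ContinuousLinearMap.orthogonalComplement_iSup_eigenspaces_eq_bot
      (isCompactOperator_starInverse N D k L hL) (starInverse_isSymmetric N D k L hL)]
  refine Submodule.orthogonal_le (iSup_le fun μ η hη => ?_)
  have hη' : starInverse N D k L hL η = μ • η := Module.End.mem_eigenspace_iff.1 hη
  rcases lt_trichotomy μ 0 with hμ | hμ | hμ
  · have hpos : 0 < (k * μ)⁻¹ := inv_pos.2 (mul_pos_of_neg_of_neg hk hμ)
    refine mem_span_of_eigenvalue_neg α β hD hDN hk hL hσ (Real.sqrt_pos.2 hpos) ?_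
    rw [hη', Real.sq_sqrt hpos.le, mul_inv, inv_inv, inv_mul_cancel_left₀ hk.ne]
  · rw [hμ, zero_smul] at hη'
    rw [starInverse_injective hL (conductivity_ne_zero hk) hσ hη']
    exact Submodule.zero_mem _
  · refine mem_span_of_eigenvalue_pos α β hD hDN hk hL hσ (Real.sqrt_pos.2 (inv_pos.2 hμ)) ?_
    rw [hη', Real.sq_sqrt (inv_pos.2 hμ).le, inv_inv]

/-! ### Orthonormality of the modes -/

theorem starMode_norm (hD : 1 ≤ D) (hDN : D < N) (hk : k < 0) (hL : 0 < L)
    (i : ModeIndex N D k) : ‖starMode N D k L α β i‖ = 1 := by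
  obtain ⟨u, v, hu, hu0, -⟩ := exists_classical_mode hD hDN hk hL α β i
  rw [hu, normalized, norm_smul, norm_inv, norm_norm, inv_mul_cancel₀ (norm_ne_zero_iff.2 hu0)]

theorem modeEigenvalue_pos_or_neg (hk : k < 0) (hL : 0 < L) :
    (∀ (n : ℕ+) m, 0 < modeEigenvalue N D k L (.sinePos n m)) ∧
    (∀ (n : ℕ+) m, modeEigenvalue N D k L (.sineNeg n m) < 0) ∧
    (∀ a, modeEigenvalue N D k L (.mixedA a) < 0) ∧
    (∀ b, 0 < modeEigenvalue N D k L (.mixedB b)) := by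
  have hn : ∀ n : ℕ+, 0 < ((n : ℝ) * Real.pi / L) ^ 2 := fun n => by
    have : (0 : ℝ) < n := by exact_mod_cast n.pos
    positivity
  refine ⟨fun n _ => hn n, fun n _ => mul_neg_of_neg_of_pos hk (hn n), fun a => ?_, fun b => ?_⟩
  · exact mul_neg_of_neg_of_pos hk (pow_pos (div_pos a.2.1 hL) 2)
  · exact pow_pos (div_pos b.2.1 hL) 2

theorem modeEigenvalue_ne_zero (hk : k < 0) (hL : 0 < L) (i : ModeIndex N D k) :
    modeEigenvalue N D k L i ≠ 0 := by
  obtain ⟨h1, h2, h3, h4⟩ := modeEigenvalue_pos_or_neg (N := N) (D := D) hk hL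
  cases i with
  | sinePos n m => exact (h1 n m).ne'
  | sineNeg n m => exact (h2 n m).ne
  | mixedA a => exact (h3 a).ne
  | mixedB b => exact (h4 b).ne'

/-- Modes with different eigenvalues are orthogonal because the inverse is symmetric. -/
theorem inner_starMode_of_ne (hD : 1 ≤ D) (hDN : D < N) (hk : k < 0) (hL : 0 < L)
    (hσ : ∑ j, conductivity N D k j ≠ 0) {i i' : ModeIndex N D k}
    (h : modeEigenvalue N D k L i ≠ modeEigenvalue N D k L i') :
    inner ℝ (starMode N D k L α β i) (starMode N D k L α β i') = 0 := by
  have heig : ∀ i, starInverse N D k L hL (starMode N D k L α β i) =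
      (modeEigenvalue N D k L i)⁻¹ • starMode N D k L α β i := by
    intro i
    obtain ⟨u, v, hu, -, hcl⟩ := exists_classical_mode hD hDN hk hL α β i
    rw [hu, normalized, map_smul, hcl.starInverse_eq hL (conductivity_ne_zero hk) hσ
      (modeEigenvalue_ne_zero hk hL i), smul_comm]
  have h1 := starInverse_isSymmetric N D k L hL (starMode N D k L α β i) (starMode N D k L α β i')
  rw [ContinuousLinearMap.coe_coe, heig, heig, real_inner_smul_left, real_inner_smul_right] at h1
  by_contra h0
  exact h (inv_injective (mul_right_cancel₀ h0 h1))

/-- Distinct modes with a common eigenvalue are sine modes of one phase and of the same frequency,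
since the dispersion roots are not multiples of `π`. -/
theorem starMode_orthonormal (hD : 1 ≤ D) (hDN : D < N) (hk : k < 0) (hL : 0 < L)
    (hσ : ∑ j, conductivity N D k j ≠ 0) : Orthonormal ℝ (starMode N D k L α β) := by
  refine ⟨starMode_norm α β hD hDN hk hL, fun i i' hne => ?_⟩
  by_cases h : modeEigenvalue N D k L i = modeEigenvalue N D k L i'
  swap
  · exact inner_starMode_of_ne α β hD hDN hk hL hσ h
  obtain ⟨h1, h2, h3, h4⟩ := modeEigenvalue_pos_or_neg (N := N) (D := D) hk hL
  have hdiv : ∀ {x y : ℝ}, 0 < x → 0 < y → (x / L) ^ 2 = (y / L) ^ 2 → x = y := by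
    intro x y hx hy hxy
    rw [sq_eq_sq₀ (by positivity) (by positivity)] at hxy
    exact (div_left_inj' hL.ne').1 hxy
  have hn : ∀ n : ℕ+, (0 : ℝ) < n * Real.pi := fun n => by
    have : (0 : ℝ) < n := by exact_mod_cast n.pos
    positivity
  have hnn : ∀ {n n' : ℕ+}, (n : ℝ) * Real.pi = n' * Real.pi → n = n' := by
    intro n n' h
    exact PNat.coe_injective (by exact_mod_cast mul_right_cancel₀ Real.pi_ne_zero h)
  have hA : ∀ (n : ℕ+) (a : {a : ℝ // IsDispersionRootA N D k a}), (n : ℝ) * Real.pi ≠ a := by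
    intro n a ha
    have := a.2.tan_pos hD hDN hk
    rw [← ha, tan_nat_mul_pi_eq_zero] at this
    exact lt_irrefl _ this
  have hB : ∀ (n : ℕ+) (b : {b : ℝ // IsDispersionRootB N D k b}), (n : ℝ) * Real.pi ≠ b := by
    intro n b hb
    have := b.2.tan_pos hD hDN hk
    rw [← hb, tan_nat_mul_pi_eq_zero] at this
    exact lt_irrefl _ this
  cases i with
  | sinePos n m =>
    cases i' with
    | sinePos n' m' =>
      obtain rfl := hnn (hdiv (hn n) (hn n') h)
      exact inner_normalized_sineMode hL.le (α n) (fun hm => hne (by rw [hm])) n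
    | sineNeg n' m' => exact absurd h ((h2 n' m').trans (h1 n m)).ne'
    | mixedA a => exact absurd h ((h3 a).trans (h1 n m)).ne'
    | mixedB b => exact absurd (hdiv (hn n) b.2.1 h) (hB n b)
  | sineNeg n m =>
    cases i' with
    | sinePos n' m' => exact absurd h ((h2 n m).trans (h1 n' m')).ne
    | sineNeg n' m' =>
      obtain rfl := hnn (hdiv (hn n) (hn n') (mul_left_cancel₀ hk.ne h))
      exact inner_normalized_sineMode hL.le (β n) (fun hm => hne (by rw [hm])) n
    | mixedA a => exact absurd (hdiv (hn n) a.2.1 (mul_left_cancel₀ hk.ne h)) (hA n a)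
    | mixedB b => exact absurd h ((h2 n m).trans (h4 b)).ne
  | mixedA a =>
    cases i' with
    | sinePos n' m' => exact absurd h ((h3 a).trans (h1 n' m')).ne
    | sineNeg n' m' =>
      exact absurd (hdiv (hn n') a.2.1 (mul_left_cancel₀ hk.ne h.symm)) (hA n' a)
    | mixedA a' =>
      exact absurd (Subtype.ext (hdiv a.2.1 a'.2.1 (mul_left_cancel₀ hk.ne h)))
        (fun ha => hne (by rw [ha]))
    | mixedB b => exact absurd h ((h3 a).trans (h4 b)).ne
  | mixedB b =>
    cases i' with
    | sinePos n' m' => exact absurd (hdiv (hn n') b.2.1 h.symm) (hB n' b)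
    | sineNeg n' m' => exact absurd h ((h2 n' m').trans (h4 b)).ne'
    | mixedA a => exact absurd h ((h3 a).trans (h4 b)).ne'
    | mixedB b' =>
      exact absurd (Subtype.ext (hdiv b.2.1 b'.2.1 h)) (fun hb => hne (by rw [hb]))

end Completeness

theorem mainTheorem10 (N D : ℕ) (hD : 1 ≤ D) (hDN : D < N) (k L : ℝ) (hk : k < 0) (hL : 0 < L)
    (hres : |k| ≠ (D : ℝ) / ((N : ℝ) - D))
    (α : ℕ+ → OrthonormalBasis (Fin (D - 1)) ℝ (zeroSum N (positivePhase N D)))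
    (β : ℕ+ → OrthonormalBasis (Fin (N - D - 1)) ℝ (zeroSum N (negativePhase N D))) :
    -- location of the dispersion roots
    (∀ n : ℕ, 1 ≤ n →
      (∃! a : ℝ, a ∈ Set.Ioo (n * Real.pi) ((n + 1) * Real.pi) ∧ IsDispersionRootA N D k a) ∧
      (∃! b : ℝ, b ∈ Set.Ioo (n * Real.pi) ((n + 1) * Real.pi) ∧ IsDispersionRootB N D k b)) ∧
    ((D : ℝ) / ((N : ℝ) - D) < |k| →
      (∃! a : ℝ, a ∈ Set.Ioo 0 Real.pi ∧ IsDispersionRootA N D k a) ∧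
      ¬ ∃ b : ℝ, b ∈ Set.Ioo 0 Real.pi ∧ IsDispersionRootB N D k b) ∧
    (|k| < (D : ℝ) / ((N : ℝ) - D) →
      (∃! b : ℝ, b ∈ Set.Ioo 0 Real.pi ∧ IsDispersionRootB N D k b) ∧
      ¬ ∃ a : ℝ, a ∈ Set.Ioo 0 Real.pi ∧ IsDispersionRootA N D k a) ∧
    -- the modes are eigenfunctions and form a complete orthonormal system
    (∀ i : ModeIndex N D k,
      IsStarEigenfunction N D k L (modeEigenvalue N D k L i) (starMode N D k L α β i)) ∧
    Orthonormal ℝ (starMode N D k L α β) ∧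
    (Submodule.span ℝ (Set.range (starMode N D k L α β))).topologicalClosure = ⊤ := by
  have hs := sqrt_abs_pos hk
  have hs2 : √|k| * √|k| = |k| := Real.mul_self_sqrt (abs_nonneg k)
  have hD0 : (0 : ℝ) < D := by exact_mod_cast hD
  have hND : (0 : ℝ) < (N : ℝ) - D := sub_pos.2 (by exact_mod_cast hDN)
  have hσ := sum_conductivity_ne_zero hDN hk hres
  have hcA : 0 < √|k| * ((N : ℝ) - D) / D := by positivity
  have hcB : 0 < D / (√|k| * ((N : ℝ) - D)) := by positivity
  -- the slopes at `0` of the right-hand sides of the two dispersion relations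
  have hslopeA : √|k| * ((N : ℝ) - D) / D * √|k| = |k| * ((N : ℝ) - D) / D := by
    linear_combination (((N : ℝ) - D) / D) * hs2
  have hslopeB : D / (√|k| * ((N : ℝ) - D)) * (√|k|)⁻¹ = D / (|k| * ((N : ℝ) - D)) := by
    rw [← div_eq_mul_inv, div_div, mul_right_comm, hs2]
  have hk0 : 0 < |k| := abs_pos.2 hk.ne
  simp only [IsDispersionRootA, IsDispersionRootB, div_eq_inv_mul _ √|k|]
  refine ⟨fun n hn => ⟨existsUnique_dispersion_root hs hcA hn,
    existsUnique_dispersion_root (inv_pos.2 hs) hcB hn⟩, fun h => ⟨?_, ?_⟩, fun h => ⟨?_, ?_⟩,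
    fun i => ?_, starMode_orthonormal α β hD hDN hk hL hσ,
    span_starMode_topologicalClosure α β hD hDN hk hL hσ⟩
  · refine existsUnique_dispersion_root_zero hs hcA ?_
    rw [hslopeA, one_lt_div hD0]
    exact (div_lt_iff₀ hND).1 h
  · refine no_dispersion_root_zero (inv_pos.2 hs) hcB ?_
    rw [hslopeB, div_le_one (by positivity)]
    exact ((div_lt_iff₀ hND).1 h).le
  · refine existsUnique_dispersion_root_zero (inv_pos.2 hs) hcB ?_
    rw [hslopeB, one_lt_div (by positivity)]
    exact (lt_div_iff₀ hND).1 h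
  · refine no_dispersion_root_zero hs hcA ?_
    rw [hslopeA, div_le_one hD0]
    exact ((lt_div_iff₀ hND).1 h).le
  · obtain ⟨u, v, hu, hu0, hcl⟩ := exists_classical_mode hD hDN hk hL α β i
    rw [hu]
    exact hcl.isStarEigenfunction hL (conductivity_ne_zero hk) hu0
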